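/- **Setting.** Let $C=[m]$ be a set of $m$ experts and let $P$ be a probability distribution on the strict rankings (permutations) of $C$; each task drawn has an independent ranking $\pi\sim P$, which is accessible only through pairwise comparisons "is $a\succ_\pi b$?". Write $\mathrm{rank}_\pi(c)\in\{1,\dots,m\}$ (rank $1$ is best), $r_\pi(S)=\min_{c\in S}\mathrm{rank}_\pi(c)$ (and $r_\pi(\varnothing)=m+1$), and $$\mathrm{WIN}(S,S')=\mathbb E_{\pi\sim P}\big[\mathbf 1\{r_\pi(S)<r_\pi(S')\}+\tfrac12\mathbf 1\{r_\pi(S)=r_\pi(S')\}\big].$$ Let $\theta(S)=\min_{x\in C\setminus S}\mathrm{WIN}(S,\{x\})$ for $S\subsetneq C$, with $\theta(C)=1$, and $\theta_k^*=\max_{|S|=k}\theta(S)$. For $x\in C$ let $g_x(S)=\Pr_{\pi\sim P}[\exists c\in S:\ \mathrm{rank}_\pi(c)\le \mathrm{rank}_\pi(x)]$. Ties in an argmax and other free choices below are resolved by an arbitrary fixed selection rule, which picks a member of each nonempty set of experts. **Fixed-$\lambda$ oracle** (rival distribution $\lambda$ on $C$, accuracy $\varepsilon'$, confidence $\delta'$).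 Say that a pair $(\pi,x)$ fails $S$ if no $s\in S$ satisfies $s=x$ or $s\succ_\pi x$. Start with $S=\varnothing$ and repeat $k$ times: 1. Draw $L=\lceil 128k^2\varepsilon'^{-2}\log(4k/\delta')\rceil$ independent pairs $(\pi,x)\sim P\times\lambda$; let $\hat\rho$ be the fraction that fails $S$ and let $\bar\rho=\min\{1,\hat\rho+\varepsilon'/(16k)\}$. 2. If $\bar\rho\le\varepsilon'/(4k)$, pad $S$ to size $k$, return it and stop. 3. Otherwise put $\eta'=\varepsilon'/(4k\bar\rho)$, $\delta''=\delta'/(2k)$, $A_1=C\setminus S$. In rounds $r=1,2,\dots$ draw a fresh pair $(\pi_r,x_r)\sim P\times\lambda$ conditioned on failing $S$ and observe $X_{r,c}=\mathbf 1\{c=x_r\text{ or }c\succ_{\pi_r}x_r\}$ for $c\in A_r$; let $\hat q_r(c)=\frac1r\sum_{s\le r}X_{s,c}$ and $\mathrm{rad}_r=\sqrt{\tfrac1{2r}\log(4|A_1|r^2/\delta'')}$; keep $A_{r+1}=\{c\in A_r:\hat q_r(c)+\mathrm{rad}_r\ge\max_{a\in A_r}\hat q_r(a)-\mathrm{rad}_r-\eta'\}$.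 As soon as $\mathrm{rad}_r\le\eta'/4$ or $|A_{r+1}|=1$, stop these rounds and add to $S$ a maximizer of $\hat q_r$ over $A_{r+1}$. If step 2 never returns, return $S$ after the $k$ repetitions. **Minimax wrapper** ($R$ rounds, $T$ audit tasks per round, learning rate $\eta$). In round $t=1,\dots,R$ let $\lambda_t(x)\propto\exp\big(\eta\sum_{s<t}(1-\hat g_s(x))\big)$; call the fixed-$\lambda$ oracle with $\lambda=\lambda_t$, accuracy $\varepsilon/4$ and confidence $\delta/(2R)$ to obtain $S_t$. Then audit $S_t$ on $T$ fresh tasks: on each, find the best member of $S_t$ and compare it with every expert outside $S_t$. Let $\hat g_t(x)=1$ for $x\in S_t$, and for $x\notin S_t$ let $\hat g_t(x)$ be the fraction of the $T$ tasks on which the best member of $S_t$ beats $x$. **Theorem.** There is a universal constant $K>0$ such that for all integers $1\le k<m$ and all $\varepsilon,\delta\in(0,1)$ there are integers $R\ge1$, $T\ge 0$ and a learning rate $\eta>0$, depending only on $(m,k,\varepsilon,\delta)$, with $R\le K\varepsilon^{-2}\log m$, such that for every distribution $P$ and every selection rule the minimax wrapper has the following properties. It always makes exactly $R$ calls to the fixed-$\lambda$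 oracle, uses at most $$K\cdot R\cdot\frac{m}{\varepsilon^2}\log\frac{mR}{\delta}$$ additional pairwise comparisons for the audits, and outputs committees $S_1,\dots,S_R$ with $|S_t|=k$; their union $S^+=\bigcup_{t=1}^R S_t$ satisfies $|S^+|\le kR$. Moreover, with probability at least $1-\delta$, the following two bounds hold simultaneously, where $p$ is the uniform distribution over $S_1,\dots,S_R$ (counted with multiplicity): $$\mathbb E_{S\sim p}[g_x(S)]\ \ge\ (1-1/e)\,\theta_k^*-\varepsilon\quad\text{for every }x\in C,\qquad\text{and}\qquad \theta(S^+)\ \ge\ (1-1/e)\,\theta_k^*-\varepsilon .$$ -/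

import Mathlib

noncomputable section

namespace PairwiseCommittee

/-! ### Probability over discrete laws -/

/-- Probability of the event `E` under the discrete law `p`. -/
def prob {α : Type} (p : PMF α) (E : Set α) : ℝ := (p.toOuterMeasure E).toReal

/-- Expectation of `f` under a law `p` on a finite type. -/
def expect {α : Type} [Fintype α] (p : PMF α) (f : α → ℝ) : ℝ := ∑ a, (p a).toReal * f a

/-- The law of `n` independent draws from `p`. -/
def iid {α : Type} (p : PMF α) : (n : ℕ) → PMF (Fin n → α)
  | 0 => PMF.pure Fin.elim0
  | n + 1 => p.bind fun a => (iid p n).map fun v => Fin.cons a v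

/-! ### Rankings, committees, win rates -/

/-- A strict ranking of the experts `Fin m`; `π c` is the zero-based position of `c`. -/
abbrev Ranking (m : ℕ) := Equiv.Perm (Fin m)

/-- The position of `c` in `π`, in `{1, …, m}`; rank `1` is best. -/
def rank {m : ℕ} (π : Ranking m) (c : Fin m) : ℕ := (π c : ℕ) + 1

/-- The answer of the pairwise feedback oracle: is `a` ranked above `b`? -/
def query {m : ℕ} (π : Ranking m) (a b : Fin m) : Bool := decide (rank π a < rank π b)

/-- Rank of the best member of `S`; the empty committee is placed below every expert. -/
def bestRank {m : ℕ} (π : Ranking m) (S : Finset (Fin m)) : ℕ :=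
  if h : S.Nonempty then S.inf' h (rank π) else m + 1

/-- The pairwise win rate of `S` against `S'`, with half credit for ties. -/
def win {m : ℕ} (P : PMF (Ranking m)) (S S' : Finset (Fin m)) : ℝ :=
  expect P fun π =>
    (if bestRank π S < bestRank π S' then 1 else 0) +
      1 / 2 * (if bestRank π S = bestRank π S' then 1 else 0)

/-- `θ(S) = min_{x ∉ S} WIN(S, {x})`, with the convention `θ(C) = 1` for the set `C` of all
experts. -/
def theta {m : ℕ} (P : PMF (Ranking m)) (S : Finset (Fin m)) : ℝ :=
  if h : Sᶜ.Nonempty then Sᶜ.inf' h (fun x => win P S {x}) else 1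

/-- `θ*_k`, the maximum of `θ` over the committees of size `k` (used for `1 ≤ k < m`). -/
def thetaStar {m : ℕ} (P : PMF (Ranking m)) (k : ℕ) : ℝ :=
  if h : (Finset.powersetCard k (Finset.univ : Finset (Fin m))).Nonempty then
    (Finset.powersetCard k Finset.univ).sup' h (theta P)
  else 0

/-- The prefix of `π` up to `x`: the experts ranked at least as highly as `x`. -/
def prefixUpTo {m : ℕ} (π : Ranking m) (x : Fin m) : Finset (Fin m) :=
  Finset.univ.filter fun c => rank π c ≤ rank π x

/-- `g_x(S)`, the probability that some member of `S` is ranked at least as highly as `x`. -/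
def g {m : ℕ} (P : PMF (Ranking m)) (x : Fin m) (S : Finset (Fin m)) : ℝ :=
  prob P {π | (S ∩ prefixUpTo π x).Nonempty}

/-! ### Arbitrary choices made by the algorithms -/

/-- A rule for the choices that the algorithms leave open (ties in an `argmax`, padding of a
committee): it selects a member of every nonempty set of experts. -/
structure SelectionRule (m : ℕ) where
  select : Finset (Fin m) → Fin m
  select_mem : ∀ A : Finset (Fin m), A.Nonempty → select A ∈ A

/-- The maximizers of `f` on `A`. -/
def argmaxSet {m : ℕ} (A : Finset (Fin m)) (f : Fin m → ℝ) : Finset (Fin m) :=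
  A.filter fun c => ∀ c' ∈ A, f c' ≤ f c

/-- Add `n` further experts to `S`. -/
def padBy {m : ℕ} (sel : SelectionRule m) : ℕ → Finset (Fin m) → Finset (Fin m)
  | 0, S => S
  | n + 1, S => padBy sel n (insert (sel.select Sᶜ) S)

/-! ### The fixed-weight oracle: failure-conditioned weighted ordinal greedy -/

/-- The law of a tentative pair: a task's ranking and an independent rival drawn from `lam`. -/
def pairLaw {m : ℕ} (P : PMF (Ranking m)) (lam : PMF (Fin m)) : PMF (Ranking m × Fin m) :=
  P.bind fun π => lam.map fun x => (π, x)

/-- The outcome of scanning `S` on the pair `(π, x)`: no member of `S` equals `x` or is reported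
to be ranked above `x`. -/
def Fails {m : ℕ} (S : Finset (Fin m)) (p : Ranking m × Fin m) : Prop :=
  ∀ s ∈ S, s ≠ p.2 ∧ query p.1 s p.2 = false

instance {m : ℕ} (S : Finset (Fin m)) : DecidablePred (Fails S) := fun p =>
  inferInstanceAs (Decidable (∀ s ∈ S, s ≠ p.2 ∧ query p.1 s p.2 = false))

open Classical in
/-- The law of an accepted failed pair: a tentative pair conditioned on failing `S` (this is what
rejection sampling returns).  When failing has probability zero there is nothing to condition on,
and the value is irrelevant: the greedy algorithm asks for such a pair only after having observed
a failure. -/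
def failedPairLaw {m : ℕ} (P : PMF (Ranking m)) (lam : PMF (Fin m)) (S : Finset (Fin m)) :
    PMF (Ranking m × Fin m) :=
  if h : ∃ p ∈ {p | Fails S p}, p ∈ (pairLaw P lam).support then
    (pairLaw P lam).filter {p | Fails S p} h
  else pairLaw P lam

/-- The confidence radius after `r` rounds, with `n` initial candidates. -/
def rad (n r : ℕ) (δ : ℝ) : ℝ :=
  Real.sqrt (1 / (2 * (r : ℝ)) * Real.log (4 * (n : ℝ) * (r : ℝ) ^ 2 / δ))

/-- The rounds of the elimination procedure.  `r` rounds have been played, `A` is the active set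
and `w c` is the sum of the observations of `c`.  The first argument bounds the number of further
rounds; `n` is the size of the initial candidate set. -/
def elimLoop {m : ℕ} (P : PMF (Ranking m)) (lam : PMF (Fin m)) (sel : SelectionRule m)
    (S : Finset (Fin m)) (n : ℕ) (η δ : ℝ) :
    (fuel : ℕ) → (r : ℕ) → (A : Finset (Fin m)) → (w : Fin m → ℕ) → PMF (Fin m)
  | 0, _, A, _ => PMF.pure (sel.select A)
  | fuel + 1, r, A, w => (failedPairLaw P lam S).bind fun p =>
      let w' : Fin m → ℕ := fun c =>
        if c ∈ A then
          w c + (if c = p.2 then 1 else if query p.1 c p.2 = true then 1 else 0)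
        else w c
      let q : Fin m → ℝ := fun c => (w' c : ℝ) / ((r + 1 : ℕ) : ℝ)
      let ρ : ℝ := rad n (r + 1) δ
      let best : Fin m := sel.select (argmaxSet A q)
      let A' : Finset (Fin m) := A.filter fun c => q best - ρ - η ≤ q c + ρ
      if ρ ≤ η / 4 ∨ A'.card = 1 then PMF.pure (sel.select (argmaxSet A' q))
      else elimLoop P lam sel S n η δ fuel (r + 1) A' w'

/-- The first round at which the confidence radius is at most `η / 4`.  The radius tends to `0`,
so there is one, and the elimination procedure always stops by then. -/
def elimHorizon (n : ℕ) (η δ : ℝ) : ℕ := sInf {r : ℕ | 1 ≤ r ∧ rad n r δ ≤ η / 4}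

/-- Failure-conditioned successive elimination among the candidates `A`. -/
def ordinalFailCondElim {m : ℕ} (P : PMF (Ranking m)) (lam : PMF (Fin m)) (sel : SelectionRule m)
    (S A : Finset (Fin m)) (η δ : ℝ) : PMF (Fin m) :=
  elimLoop P lam sel S A.card η δ (elimHorizon A.card η δ) 0 A (fun _ => 0)

/-- The number of tentative pairs used to estimate a failure rate. -/
def numTentative (k : ℕ) (ε δ : ℝ) : ℕ :=
  ⌈128 * (k : ℝ) ^ 2 / ε ^ 2 * Real.log (4 * (k : ℝ) / δ)⌉₊

/-- The greedy iterations; the first numeric argument is the number of iterations left. -/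
def greedyLoop {m : ℕ} (P : PMF (Ranking m)) (lam : PMF (Fin m)) (sel : SelectionRule m)
    (k : ℕ) (ε δ : ℝ) : ℕ → Finset (Fin m) → PMF (Finset (Fin m))
  | 0, S => PMF.pure S
  | i + 1, S => (iid (pairLaw P lam) (numTentative k ε δ)).bind fun v =>
      let ρhat : ℝ :=
        ((Finset.univ.filter fun j => Fails S (v j)).card : ℝ) / (numTentative k ε δ : ℝ)
      let ρbar : ℝ := min 1 (ρhat + ε / (16 * (k : ℝ)))
      if ρbar ≤ ε / (4 * (k : ℝ)) then PMF.pure (padBy sel (k - S.card) S)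
      else
        (ordinalFailCondElim P lam sel S Sᶜ (ε / (4 * (k : ℝ) * ρbar)) (δ / (2 * (k : ℝ)))).bind
          fun c => greedyLoop P lam sel k ε δ i (insert c S)

/-- The output law of the fixed-weight oracle with rival weights `lam`, accuracy `ε` and
confidence `δ`. -/
def fixedWeightOracle {m : ℕ} (P : PMF (Ranking m)) (sel : SelectionRule m) (k : ℕ)
    (lam : PMF (Fin m)) (ε δ : ℝ) : PMF (Finset (Fin m)) :=
  greedyLoop P lam sel k ε δ k ∅

/-! ### Auditing a committee on one task, with the comparisons counted -/

/-- An adaptive comparison procedure on a single task: the task's ranking is accessible only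
through the answers to pairwise queries. -/
inductive CompTree (m : ℕ) (β : Type) : Type
  | leaf (b : β) : CompTree m β
  | query (a b : Fin m) (next : Bool → CompTree m β) : CompTree m β

/-- Run a comparison procedure on a task with ranking `π`: the result and the number of pairwise
comparisons made. -/
def CompTree.run {m : ℕ} {β : Type} (π : Ranking m) : CompTree m β → β × ℕ
  | .leaf b => (b, 0)
  | .query a b next =>
      let r := CompTree.run π (next (PairwiseCommittee.query π a b))
      (r.1, r.2 + 1)

/-- Find the best expert among `cur` and the members of a list, then continue with it. -/
def findTop {m : ℕ} {β : Type} :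
    Fin m → List (Fin m) → (Fin m → CompTree m β) → CompTree m β
  | cur, [], next => next cur
  | cur, a :: l, next => .query a cur fun b => findTop (if b then a else cur) l next

/-- Compare `s` with every member of a list, collecting in `acc` those that `s` beats. -/
def compareAll {m : ℕ} (s : Fin m) :
    List (Fin m) → Finset (Fin m) → CompTree m (Finset (Fin m))
  | [], acc => .leaf acc
  | x :: l, acc => .query s x fun b => compareAll s l (if b then insert x acc else acc)

/-- The audit of `S` on one task: find the best member of `S`, compare it with every expert
outside `S`, and return the set of outside experts that it beats. -/
def auditTask {m : ℕ} (S : Finset (Fin m)) : CompTree m (Finset (Fin m)) :=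
  match S.toList with
  | [] => .leaf ∅
  | a :: l => findTop a l fun s => compareAll s Sᶜ.toList ∅

/-! ### The minimax wrapper: multiplicative weights over rivals -/

/-- The multiplicative-weights distribution: `x` has probability proportional to
`exp (η * G x)`, where `G x` is the accumulated gain of `x`. -/
def mwDist {m : ℕ} [NeZero m] (η : ℝ) (G : Fin m → ℝ) : PMF (Fin m) :=
  PMF.normalize (fun x => ENNReal.ofReal (Real.exp (η * G x)))
    (by
      intro h
      have h0 := ENNReal.tsum_eq_zero.mp h 0
      exact absurd (ENNReal.ofReal_eq_zero.mp h0) (not_le.mpr (Real.exp_pos _)))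
    (by
      rw [tsum_fintype]
      exact ENNReal.sum_ne_top.mpr fun _ _ => ENNReal.ofReal_ne_top)

/-- The state of the wrapper after `t` rounds. -/
structure WrapperState (m t : ℕ) where
  /-- the sum of the estimated violation vectors so far -/
  gain : Fin m → ℝ
  /-- the committees returned by the oracle so far -/
  committees : Fin t → Finset (Fin m)
  /-- the number of calls to the fixed-weight oracle so far -/
  oracleCalls : ℕ
  /-- the number of pairwise comparisons used for audits so far -/
  auditComparisons : ℕ

/-- The state before the first round. -/
def WrapperState.init (m : ℕ) : WrapperState m 0 where
  gain := fun _ => 0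
  committees := Fin.elim0
  oracleCalls := 0
  auditComparisons := 0

/-- The audit estimate of `g_x(S)` from the tasks with rankings `v 0, …, v (T - 1)`. -/
def gHat {m T : ℕ} (S : Finset (Fin m)) (v : Fin T → Ranking m) (x : Fin m) : ℝ :=
  if x ∈ S then 1
  else ((Finset.univ.filter fun j => x ∈ ((auditTask S).run (v j)).1).card : ℝ) / (T : ℝ)

/-- One round: call the oracle (accuracy `ε'`, confidence `δ'`) at the current rival
distribution, then audit the returned committee on `T` fresh tasks and update the weights with
the estimated violations. -/
def wrapperRound {m t : ℕ} [NeZero m] (P : PMF (Ranking m)) (sel : SelectionRule m) (k : ℕ)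
    (ε' δ' : ℝ) (T : ℕ) (η : ℝ) (s : WrapperState m t) : PMF (WrapperState m (t + 1)) :=
  (fixedWeightOracle P sel k (mwDist η s.gain) ε' δ').bind fun S =>
    (iid P T).map fun v =>
      { gain := fun x => s.gain x + (1 - gHat S v x)
        committees := Fin.snoc (α := fun _ => Finset (Fin m)) s.committees S
        oracleCalls := s.oracleCalls + 1
        auditComparisons := s.auditComparisons + ∑ j, ((auditTask S).run (v j)).2 }

/-- The law of the wrapper's state after `t` rounds. -/
def wrapperRun {m : ℕ} [NeZero m] (P : PMF (Ranking m)) (sel : SelectionRule m) (k : ℕ)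
    (ε' δ' : ℝ) (T : ℕ) (η : ℝ) : (t : ℕ) → PMF (WrapperState m t)
  | 0 => PMF.pure (WrapperState.init m)
  | t + 1 => (wrapperRun P sel k ε' δ' T η t).bind (wrapperRound P sel k ε' δ' T η)

/-- The minimax wrapper with `R` rounds, `T` audit tasks per round and learning rate `η`; every
oracle call has accuracy `ε / 4` and confidence `δ / (2R)`. -/
def minimaxWrapper {m : ℕ} [NeZero m] (P : PMF (Ranking m)) (sel : SelectionRule m) (k : ℕ)
    (ε δ : ℝ) (R T : ℕ) (η : ℝ) : PMF (WrapperState m R) :=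
  wrapperRun P sel k (ε / 4) (δ / (2 * (R : ℝ))) T η R

/-- The uniform distribution over `S 0, …, S (R - 1)`, as a law on committees. -/
def lottery {m R : ℕ} [NeZero R] (S : Fin R → Finset (Fin m)) : PMF (Finset (Fin m)) :=
  (PMF.uniformOfFintype (Fin R)).map S

/-- The union of the committees `S 0, …, S (R - 1)`. -/
def unionCommittee {m R : ℕ} (S : Fin R → Finset (Fin m)) : Finset (Fin m) :=
  Finset.univ.biUnion S

end PairwiseCommittee

end

open PairwiseCommittee

noncomputable section

namespace PairwiseCommittee

/-! ### Discrete probability -/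

/-! For a fixed rival law `lam`, the `lam`-average of `g P x S` is `1 - failRate P lam S`
(`expect_g`), a monotone submodular coverage function of `S`. A greedy step that is optimal up to `ε
/ (8k)` shrinks the gap to any `k`-set `T` by the factor `1 - 1/k`, up to that error, so `k` steps
leave at most a fraction `1/e` of the initial gap. Taking for `T` a maximizer of `theta`, which
covers every rival with probability at least `thetaStar P k`, shows that one comparator serves every
`lam`; no minimax theorem is needed. This is `greedyLoop_good` and `fixedWeightOracle_good`.

Each greedy step learns marginal gains on failed pairs only. A marginal gain is the failure rate
times a conditional coverage (`failRate_mul_expect_failedPairLaw`), so the conditional accuracy may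
be coarser when failures are rare. Successive elimination reaches this accuracy
(`ordinalFailCondElim_good`), by Hoeffding's inequality and a union bound over candidates and
rounds.

Multiplicative weights turn average coverage into coverage of each rival. Every round has small
average violation under its own weights, so the exponential potential grows slowly; as each rival
contributes one term of it, no rival accumulates a large violation (`sum_exp_update_le`,
`gain_le_of_isGood`). Audits replace exact violations by empirical ones. Finally `g` is monotone in
the committee, so the union inherits the lottery's bound (`le_theta_unionCommittee`).

Failure probabilities are added along the monadic program by `toOuterMeasure_bind_le`: the first
stage is bad with mass at most `a`, and from a good outcome the next stage fails with mass at most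
`b`. -/

theorem toOuterMeasure_bind_le {α β : Type} {p : PMF α} {f : α → PMF β} {B : Set α} {E : Set β}
    {a b : ENNReal} (hB : p.toOuterMeasure B ≤ a)
    (hE : ∀ x ∈ p.support, x ∉ B → (f x).toOuterMeasure E ≤ b) :
    (p.bind f).toOuterMeasure E ≤ a + b := by
  classical
  rw [PMF.toOuterMeasure_bind_apply]
  calc ∑' x, p x * (f x).toOuterMeasure E
      ≤ ∑' x, (B.indicator p x + p x * b) := by
        refine ENNReal.tsum_le_tsum fun x => ?_
        by_cases hx : x ∈ B
        · rw [Set.indicator_of_mem hx]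
          refine le_add_right ?_
          calc p x * (f x).toOuterMeasure E ≤ p x * 1 := by
                gcongr
                rw [← ((f x).toOuterMeasure_apply_eq_one_iff Set.univ).2 (Set.subset_univ _)]
                exact MeasureTheory.measure_mono (Set.subset_univ _)
            _ = p x := mul_one _
        · rw [Set.indicator_of_notMem hx, zero_add]
          by_cases h0 : p x = 0
          · simp [h0]
          · gcongr
            exact hE x ((p.mem_support_iff x).2 h0) hx
    _ = p.toOuterMeasure B + b := by
        rw [ENNReal.tsum_add, ENNReal.tsum_mul_right, PMF.tsum_coe, one_mul,
          PMF.toOuterMeasure_apply]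
    _ ≤ a + b := by gcongr

theorem toOuterMeasure_eq_zero {α : Type} {p : PMF α} {E : Set α} (h : ∀ x ∈ p.support, x ∉ E) :
    p.toOuterMeasure E = 0 :=
  (p.toOuterMeasure_apply_eq_zero_iff E).2 (Set.disjoint_left.2 h)

theorem toOuterMeasure_ne_top {α : Type} (p : PMF α) (E : Set α) : p.toOuterMeasure E ≠ ⊤ := by
  rw [PMF.toOuterMeasure_apply]
  exact p.tsum_coe_indicator_ne_top E

theorem one_sub_le_prob {α : Type} {p : PMF α} {E : Set α} {d : ℝ} (hd : 0 ≤ d)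
    (h : p.toOuterMeasure Eᶜ ≤ ENNReal.ofReal d) : 1 - d ≤ prob p E := by
  have h1 : (1 : ENNReal) ≤ p.toOuterMeasure E + p.toOuterMeasure Eᶜ := by
    rw [← (p.toOuterMeasure_apply_eq_one_iff Set.univ).2 (Set.subset_univ _),
      ← Set.union_compl_self E]
    exact MeasureTheory.measure_union_le _ _
  have h2 := ENNReal.toReal_mono
    (ENNReal.add_ne_top.2 ⟨toOuterMeasure_ne_top p E, toOuterMeasure_ne_top p Eᶜ⟩) h1
  rw [ENNReal.toReal_add (toOuterMeasure_ne_top p E) (toOuterMeasure_ne_top p Eᶜ)] at h2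
  have h3 := ENNReal.toReal_mono ENNReal.ofReal_ne_top h
  rw [ENNReal.toReal_ofReal hd] at h3
  simp only [ENNReal.toReal_one] at h2
  unfold prob
  linarith

section Finite

variable {α : Type} [Fintype α]

theorem sum_toReal (p : PMF α) : ∑ a, (p a).toReal = 1 := by
  rw [← ENNReal.toReal_sum fun a _ => p.apply_ne_top a, ← tsum_fintype (L := .unconditional α),
    PMF.tsum_coe, ENNReal.toReal_one]

open Classical in
theorem prob_eq_expect (p : PMF α) (E : Set α) :
    prob p E = expect p fun a => if a ∈ E then 1 else 0 := by
  unfold prob expect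
  rw [PMF.toOuterMeasure_apply_fintype, ENNReal.toReal_sum]
  · refine Finset.sum_congr rfl fun a _ => ?_
    by_cases h : a ∈ E <;> simp [h]
  · intro a _
    by_cases h : a ∈ E <;> simp [h, p.apply_ne_top]

theorem expect_mono (p : PMF α) {f h : α → ℝ} (hfh : ∀ a, f a ≤ h a) :
    expect p f ≤ expect p h :=
  Finset.sum_le_sum fun a _ => mul_le_mul_of_nonneg_left (hfh a) ENNReal.toReal_nonneg

theorem expect_const (p : PMF α) (c : ℝ) : (expect p fun _ => c) = c := by
  unfold expect
  rw [← Finset.sum_mul, sum_toReal, one_mul]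

theorem expect_sub (p : PMF α) (f h : α → ℝ) :
    (expect p fun a => f a - h a) = expect p f - expect p h := by
  simp only [expect, mul_sub, Finset.sum_sub_distrib]

theorem expect_const_mul (p : PMF α) (c : ℝ) (f : α → ℝ) :
    (expect p fun a => c * f a) = c * expect p f := by
  simp only [expect, Finset.mul_sum]
  exact Finset.sum_congr rfl fun a _ => by ring

theorem expect_sum {ι : Type} (s : Finset ι) (p : PMF α) (f : ι → α → ℝ) :
    (expect p fun a => ∑ i ∈ s, f i a) = ∑ i ∈ s, expect p (f i) := by
  simp only [expect, Finset.mul_sum]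
  exact Finset.sum_comm

theorem expect_nonneg (p : PMF α) {f : α → ℝ} (hf : ∀ a, 0 ≤ f a) : 0 ≤ expect p f :=
  Finset.sum_nonneg fun a _ => mul_nonneg ENNReal.toReal_nonneg (hf a)

/-! ### Independent draws and Hoeffding's inequality. -/

theorem iid_apply (p : PMF α) (n : ℕ) (v : Fin n → α) : iid p n v = ∏ j, p (v j) := by
  classical
  induction n with
  | zero =>
    rw [iid, PMF.pure_apply, if_pos (Subsingleton.elim _ _)]
    simp
  | succ n ih =>
    rw [iid, PMF.bind_apply, tsum_fintype, Fin.prod_univ_succ, Finset.sum_eq_single (v 0)]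
    · congr 1
      rw [PMF.map_apply, tsum_eq_single (Fin.tail v)]
      · rw [if_pos (Fin.cons_self_tail v).symm, ih]
        rfl
      · intro w hw
        rw [if_neg]
        intro h
        exact hw (by rw [h, Fin.tail_cons])
    · intro a _ ha
      rw [PMF.map_apply, ENNReal.tsum_eq_zero.2, mul_zero]
      intro w
      rw [if_neg]
      rintro rfl
      exact ha (by simp)
    · simp

theorem expect_iid_prod (p : PMF α) (n : ℕ) (f : Fin n → α → ℝ) :
    (expect (iid p n) fun v => ∏ j, f j (v j)) = ∏ j, expect p (f j) := by
  classical
  unfold expect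
  rw [Finset.prod_univ_sum, Fintype.piFinset_univ]
  refine Finset.sum_congr rfl fun v _ => ?_
  rw [iid_apply, ENNReal.toReal_prod, Finset.prod_mul_distrib]

/-- Hoeffding's lemma: a variable in `[0, 1]` is sub-Gaussian with variance proxy `1/4`. The
discrete σ-algebra makes everything measurable. -/
theorem expect_exp_le (p : PMF α) {X : α → ℝ} (h0 : ∀ a, 0 ≤ X a) (h1 : ∀ a, X a ≤ 1) (s : ℝ) :
    (expect p fun a => Real.exp (s * (X a - expect p X))) ≤ Real.exp (s ^ 2 / 8) := by
  let : MeasurableSpace α := ⊤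
  have : MeasurableSingletonClass α := ⟨fun _ => trivial⟩
  have hX : AEMeasurable X p.toMeasure := (measurable_from_top).aemeasurable
  have h := ProbabilityTheory.hasSubgaussianMGF_of_mem_Icc (a := 0) (b := 1) hX
    (Filter.Eventually.of_forall fun a => ⟨h0 a, h1 a⟩)
  have h2 := h.mgf_le s
  simp only [ProbabilityTheory.mgf, PMF.integral_eq_sum, smul_eq_mul] at h2
  refine h2.trans (Real.exp_le_exp.2 (le_of_eq ?_))
  simp
  ring

theorem sum_fin_ite_lt {n r : ℕ} (hr : r ≤ n) (c : ℝ) :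
    (∑ j : Fin n, if (j : ℕ) < r then c else 0) = r * c := by
  rw [Fin.sum_univ_eq_sum_range (fun j => if j < r then c else 0) n, ← Finset.sum_filter]
  have : (Finset.range n).filter (· < r) = Finset.range r := by
    ext j
    simp only [Finset.mem_filter, Finset.mem_range]
    omega
  rw [this, Finset.sum_const, Finset.card_range, nsmul_eq_mul]

/-- Chernoff's method with exponent `4 * t`, the minimizer of `-s * t + s ^ 2 / 8`. Summing over a
prefix of a longer sample lets all rounds of elimination live on one sample space. -/
theorem hoeffding_upper (p : PMF α) {X : α → ℝ} (h0 : ∀ a, 0 ≤ X a) (h1 : ∀ a, X a ≤ 1)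
    {n r : ℕ} (hr : r ≤ n) {t : ℝ} (ht : 0 ≤ t) :
    prob (iid p n)
      {v | r * t ≤ (∑ j : Fin n, if (j : ℕ) < r then X (v j) else 0) - r * expect p X} ≤
      Real.exp (-2 * r * t ^ 2) := by
  classical
  rw [prob_eq_expect]
  set μ := expect p X with hμ
  have key : ∀ v : Fin n → α, (∑ j : Fin n, if (j : ℕ) < r then X (v j) else 0) - r * μ =
      ∑ j : Fin n, if (j : ℕ) < r then X (v j) - μ else 0 := by
    intro v
    rw [← sum_fin_ite_lt hr μ, ← Finset.sum_sub_distrib]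
    refine Finset.sum_congr rfl fun j _ => ?_
    split_ifs <;> simp
  calc (expect (iid p n) fun v => if v ∈ {v : Fin n → α | r * t ≤
          (∑ j : Fin n, if (j : ℕ) < r then X (v j) else 0) - r * μ} then 1 else 0)
      ≤ expect (iid p n) fun v => Real.exp (-(4 * t) * (r * t)) *
          ∏ j : Fin n, (fun a => if (j : ℕ) < r then Real.exp (4 * t * (X a - μ)) else 1) (v j) := by
        refine expect_mono _ fun v => ?_
        have hprod : (∏ j : Fin n,
            (fun a => if (j : ℕ) < r then Real.exp (4 * t * (X a - μ)) else 1) (v j)) =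
            Real.exp (4 * t * ∑ j : Fin n, if (j : ℕ) < r then X (v j) - μ else 0) := by
          rw [Finset.mul_sum, Real.exp_sum]
          refine Finset.prod_congr rfl fun j _ => ?_
          split_ifs <;> simp
        rw [hprod, ← Real.exp_add]
        split_ifs with hv
        · rw [Set.mem_ofPred_eq, key] at hv
          apply Real.one_le_exp
          nlinarith
        · positivity
    _ = Real.exp (-(4 * t) * (r * t)) *
          ∏ j : Fin n, expect p (fun a => if (j : ℕ) < r then Real.exp (4 * t * (X a - μ)) else 1) := by
        rw [expect_const_mul]
        exact congrArg _ (expect_iid_prod p n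
          fun j a => if (j : ℕ) < r then Real.exp (4 * t * (X a - μ)) else 1)
    _ ≤ Real.exp (-(4 * t) * (r * t)) *
          ∏ j : Fin n, Real.exp (if (j : ℕ) < r then (4 * t) ^ 2 / 8 else 0) := by
        gcongr with j
        · intro j _
          refine expect_nonneg _ fun a => ?_
          split_ifs <;> positivity
        · split_ifs
          · exact expect_exp_le p h0 h1 _
          · rw [expect_const, Real.exp_zero]
    _ = Real.exp (-2 * r * t ^ 2) := by
        rw [← Real.exp_sum, sum_fin_ite_lt hr, ← Real.exp_add]
        congr 1
        ring

theorem hoeffding_prefix (p : PMF α) {X : α → ℝ} (h0 : ∀ a, 0 ≤ X a) (h1 : ∀ a, X a ≤ 1)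
    {n r : ℕ} (hr : r ≤ n) {t : ℝ} (ht : 0 ≤ t) :
    (iid p n).toOuterMeasure
      {v | r * t ≤ |(∑ j : Fin n, if (j : ℕ) < r then X (v j) else 0) - r * expect p X|} ≤
      ENNReal.ofReal (2 * Real.exp (-2 * r * t ^ 2)) := by
  have hup := hoeffding_upper p h0 h1 hr ht
  -- The lower tail of `X` is the upper tail of `1 - X`.
  have hlo := hoeffding_upper p (X := fun a => 1 - X a) (fun a => sub_nonneg.2 (h1 a))
    (fun a => sub_le_self _ (h0 a)) hr ht
  have hsub : {v : Fin n → α |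
      r * t ≤ |(∑ j : Fin n, if (j : ℕ) < r then X (v j) else 0) - r * expect p X|} ⊆
      {v | r * t ≤ (∑ j : Fin n, if (j : ℕ) < r then X (v j) else 0) - r * expect p X} ∪
      {v | r * t ≤ (∑ j : Fin n, if (j : ℕ) < r then 1 - X (v j) else 0) -
        r * expect p fun a => 1 - X a} := by
    intro v hv
    rcases le_abs.1 (Set.mem_ofPred_eq ▸ hv) with h | h
    · exact Or.inl h
    · refine Or.inr ?_
      have hs : (∑ j : Fin n, if (j : ℕ) < r then 1 - X (v j) else 0) =
          r * 1 - ∑ j : Fin n, if (j : ℕ) < r then X (v j) else 0 := by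
        rw [← sum_fin_ite_lt hr, ← Finset.sum_sub_distrib]
        refine Finset.sum_congr rfl fun j _ => ?_
        split_ifs <;> simp
      rw [Set.mem_ofPred_eq, hs, expect_sub, expect_const]
      linarith
  refine (MeasureTheory.measure_mono hsub).trans ((MeasureTheory.measure_union_le _ _).trans ?_)
  rw [two_mul, ENNReal.ofReal_add (Real.exp_nonneg _) (Real.exp_nonneg _)]
  exact add_le_add ((ENNReal.le_ofReal_iff_toReal_le (toOuterMeasure_ne_top _ _)
    (Real.exp_nonneg _)).2 hup) ((ENNReal.le_ofReal_iff_toReal_le (toOuterMeasure_ne_top _ _)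
    (Real.exp_nonneg _)).2 hlo)

theorem hoeffding (p : PMF α) {X : α → ℝ} (h0 : ∀ a, 0 ≤ X a) (h1 : ∀ a, X a ≤ 1)
    (n : ℕ) {t : ℝ} (ht : 0 ≤ t) :
    (iid p n).toOuterMeasure {v | n * t ≤ |(∑ j : Fin n, X (v j)) - n * expect p X|} ≤
      ENNReal.ofReal (2 * Real.exp (-2 * n * t ^ 2)) := by
  simpa using hoeffding_prefix p h0 h1 (le_refl n) ht

end Finite

/-! ### Successive elimination -/

section Elimination

variable {m : ℕ}

/-- The observation of candidate `c` on the pair `p`: does `c` cover the rival? -/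
def obs (c : Fin m) (p : Ranking m × Fin m) : ℕ :=
  if c = p.2 then 1 else if query p.1 c p.2 = true then 1 else 0

theorem obs_le_one (c : Fin m) (p : Ranking m × Fin m) : obs c p ≤ 1 := by
  unfold obs
  split_ifs <;> simp

/-- The observation counts after one more round with accepted pair `p`. -/
def elimCount (A : Finset (Fin m)) (w : Fin m → ℕ) (p : Ranking m × Fin m) (c : Fin m) : ℕ :=
  if c ∈ A then w c + obs c p else w c

/-- The empirical means after one more round with accepted pair `p`. -/
def elimMean (r : ℕ) (A : Finset (Fin m)) (w : Fin m → ℕ) (p : Ranking m × Fin m)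
    (c : Fin m) : ℝ :=
  (elimCount A w p c : ℝ) / ((r + 1 : ℕ) : ℝ)

/-- The active set left by the empirical means `q` and the confidence radius `ρ`. -/
def elimActive (sel : SelectionRule m) (η ρ : ℝ) (A : Finset (Fin m)) (q : Fin m → ℝ) :
    Finset (Fin m) :=
  A.filter fun c => q (sel.select (argmaxSet A q)) - ρ - η ≤ q c + ρ

/-- The expert selected by the elimination rounds as a function of the accepted pairs. -/
def elimPath (sel : SelectionRule m) (n : ℕ) (η δ : ℝ) :
    (fuel : ℕ) → (r : ℕ) → (A : Finset (Fin m)) → (w : Fin m → ℕ) →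
      (Fin fuel → Ranking m × Fin m) → Fin m
  | 0, _, A, _, _ => sel.select A
  | fuel + 1, r, A, w, v =>
      if rad n (r + 1) δ ≤ η / 4 ∨
          (elimActive sel η (rad n (r + 1) δ) A (elimMean r A w (v 0))).card = 1 then
        sel.select (argmaxSet (elimActive sel η (rad n (r + 1) δ) A (elimMean r A w (v 0)))
          (elimMean r A w (v 0)))
      else elimPath sel n η δ fuel (r + 1)
        (elimActive sel η (rad n (r + 1) δ) A (elimMean r A w (v 0))) (elimCount A w (v 0))
        (Fin.tail v)

theorem elimLoop_succ (P : PMF (Ranking m)) (lam : PMF (Fin m)) (sel : SelectionRule m)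
    (S : Finset (Fin m)) (n : ℕ) (η δ : ℝ) (fuel r : ℕ) (A : Finset (Fin m)) (w : Fin m → ℕ) :
    elimLoop P lam sel S n η δ (fuel + 1) r A w = (failedPairLaw P lam S).bind fun p =>
      if rad n (r + 1) δ ≤ η / 4 ∨
          (elimActive sel η (rad n (r + 1) δ) A (elimMean r A w p)).card = 1 then
        PMF.pure (sel.select (argmaxSet (elimActive sel η (rad n (r + 1) δ) A (elimMean r A w p))
          (elimMean r A w p)))
      else elimLoop P lam sel S n η δ fuel (r + 1)
        (elimActive sel η (rad n (r + 1) δ) A (elimMean r A w p)) (elimCount A w p) :=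
  rfl

/-- Coupling: all pairs may be drawn in advance, with those after the stopping time ignored. The
adaptive procedure becomes a deterministic function of an iid sample, so Hoeffding applies at each
fixed round and no martingale argument is needed. -/
theorem elimLoop_eq_map (P : PMF (Ranking m)) (lam : PMF (Fin m)) (sel : SelectionRule m)
    (S : Finset (Fin m)) (n : ℕ) (η δ : ℝ) (fuel r : ℕ) (A : Finset (Fin m)) (w : Fin m → ℕ) :
    elimLoop P lam sel S n η δ fuel r A w =
      (iid (failedPairLaw P lam S) fuel).map (elimPath sel n η δ fuel r A w) := by
  induction fuel generalizing r A w with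
  | zero => rw [elimLoop, iid, PMF.pure_map, elimPath]
  | succ fuel ih =>
    rw [elimLoop_succ, iid, PMF.map_bind]
    congr 1
    funext p
    rw [PMF.map_comp, ih]
    by_cases h : rad n (r + 1) δ ≤ η / 4 ∨
      (elimActive sel η (rad n (r + 1) δ) A (elimMean r A w p)).card = 1
    -- After stopping, the remaining pairs are irrelevant: a constant map pushes their law to a
    -- point mass.
    · rw [if_pos h, ← PMF.map_const (iid (failedPairLaw P lam S) fuel)]
      congr 1
      funext v
      rw [Function.comp_apply, Function.const_apply, elimPath, Fin.cons_zero, if_pos h]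
    · rw [if_neg h]
      congr 1
      funext v
      rw [Function.comp_apply, elimPath, Fin.cons_zero, if_neg h, Fin.tail_cons]

theorem argmaxSet_nonempty {A : Finset (Fin m)} (hA : A.Nonempty) (f : Fin m → ℝ) :
    (argmaxSet A f).Nonempty := by
  obtain ⟨c, hc, hmax⟩ := A.exists_max_image f hA
  exact ⟨c, Finset.mem_filter.2 ⟨hc, hmax⟩⟩

theorem select_argmaxSet (sel : SelectionRule m) {A : Finset (Fin m)} (hA : A.Nonempty)
    (f : Fin m → ℝ) :
    sel.select (argmaxSet A f) ∈ A ∧ ∀ c ∈ A, f c ≤ f (sel.select (argmaxSet A f)) :=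
  Finset.mem_filter.1 (sel.select_mem _ (argmaxSet_nonempty hA f))

theorem elimPath_mem (sel : SelectionRule m) (n : ℕ) {η : ℝ} (hη : 0 ≤ η) (δ : ℝ) (fuel r : ℕ)
    {A : Finset (Fin m)} (hA : A.Nonempty) (w : Fin m → ℕ) (v : Fin fuel → Ranking m × Fin m) :
    elimPath sel n η δ fuel r A w v ∈ A := by
  induction fuel generalizing r A w with
  | zero => exact sel.select_mem A hA
  | succ fuel ih =>
    rw [elimPath]
    set q := elimMean r A w (v 0)
    set ρ := rad n (r + 1) δ
    set A' := elimActive sel η ρ A q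
    have hρ : 0 ≤ ρ := Real.sqrt_nonneg _
    have hA' : A'.Nonempty :=
      ⟨sel.select (argmaxSet A q), Finset.mem_filter.2 ⟨(select_argmaxSet sel hA q).1, by linarith⟩⟩
    have hsub : A' ⊆ A := Finset.filter_subset _ _
    split_ifs with h
    · exact hsub (select_argmaxSet sel hA' q).1
    · exact hsub (ih (r + 1) hA' _ (Fin.tail v))

/-- If every empirical mean stays within the confidence radius of its target `μ`, then the selected
expert is optimal up to `η / 2`. -/
theorem elimPath_good (sel : SelectionRule m) (n : ℕ) {η : ℝ} (hη : 0 ≤ η) (δ : ℝ)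
    (μ : Fin m → ℝ) (fuel r : ℕ) {A : Finset (Fin m)} (w : Fin m → ℕ)
    (v : Fin fuel → Ranking m × Fin m) (hfuel : 0 < fuel) (hrad : rad n (r + fuel) δ ≤ η / 4)
    (hdev : ∀ c ∈ A, ∀ i, 1 ≤ i → i ≤ fuel →
      |(w c : ℝ) + (∑ j : Fin fuel, if (j : ℕ) < i then (obs c (v j) : ℝ) else 0) -
        ((r + i : ℕ) : ℝ) * μ c| ≤ ((r + i : ℕ) : ℝ) * rad n (r + i) δ)
    {c₀ : Fin m} (hc₀ : c₀ ∈ A) (hmax : ∀ c ∈ A, μ c ≤ μ c₀) :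
    μ c₀ - η / 2 ≤ μ (elimPath sel n η δ fuel r A w v) := by
  induction fuel generalizing r A w with
  | zero => exact absurd hfuel (lt_irrefl 0)
  | succ fuel ih =>
    rw [elimPath]
    set q := elimMean r A w (v 0)
    set ρ := rad n (r + 1) δ
    set A' := elimActive sel η ρ A q
    have hw : ∀ c ∈ A, (elimCount A w (v 0) c : ℝ) = w c + obs c (v 0) := by
      intro c hc
      rw [elimCount, if_pos hc]
      push_cast
      rfl
    have hρ : 0 ≤ ρ := Real.sqrt_nonneg _
    have hA : A.Nonempty := ⟨c₀, hc₀⟩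
    have hq : ∀ c ∈ A, |q c - μ c| ≤ ρ := by
      intro c hc
      have h := hdev c hc 1 le_rfl (by omega)
      have hpos : (0 : ℝ) < ((r + 1 : ℕ) : ℝ) := by positivity
      have hs : (∑ j : Fin (fuel + 1), if (j : ℕ) < 1 then (obs c (v j) : ℝ) else 0) =
          obs c (v 0) := by
        rw [Fin.sum_univ_succ]
        simp
      rw [hs, ← hw c hc] at h
      have hq' : q c - μ c = ((elimCount A w (v 0) c : ℝ) - ((r + 1 : ℕ) : ℝ) * μ c) / ((r + 1 : ℕ) : ℝ) := by
        simp only [q, elimMean]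
        field_simp
      rw [hq', abs_div, abs_of_pos hpos, div_le_iff₀ hpos, mul_comm ρ]
      exact h
    have hbest := select_argmaxSet sel hA q
    -- The optimal candidate survives: `q best - ρ ≤ μ best ≤ μ c₀ ≤ q c₀ + ρ`.
    have hc₀' : c₀ ∈ A' := by
      refine Finset.mem_filter.2 ⟨hc₀, ?_⟩
      have h1 := abs_le.1 (hq _ hbest.1)
      have h2 := abs_le.1 (hq _ hc₀)
      have h3 := hmax _ hbest.1
      linarith
    have hsub : A' ⊆ A := Finset.filter_subset _ _
    have hfin := select_argmaxSet sel ⟨c₀, hc₀'⟩ q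
    -- Stopping by radius costs at most `2 * ρ ≤ η / 2`; stopping with one survivor costs nothing,
    -- as that survivor is `c₀`.
    by_cases h1 : ρ ≤ η / 4
    · rw [if_pos (Or.inl h1)]
      have h2 := abs_le.1 (hq _ hc₀)
      have h3 := abs_le.1 (hq _ (hsub hfin.1))
      have h4 := hfin.2 _ hc₀'
      linarith
    by_cases h2 : A'.card = 1
    · rw [if_pos (Or.inr h2)]
      obtain ⟨a, ha⟩ := Finset.card_eq_one.1 h2
      have e1 : c₀ = a := Finset.mem_singleton.1 (ha ▸ hc₀')
      have e2 : sel.select (argmaxSet A' q) = a := Finset.mem_singleton.1 (ha ▸ hfin.1)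
      rw [e2, e1]
      linarith
    rw [if_neg (by tauto)]
    -- The last permitted round satisfies the radius test, so the out-of-fuel branch is never
    -- reached.
    have hf : fuel ≠ 0 := by
      rintro rfl
      exact h1 hrad
    refine ih (r + 1) _ (Fin.tail v) (Nat.pos_of_ne_zero hf) ?_ ?_ hc₀'
      fun c hc => hmax c (hsub hc)
    · rwa [show r + 1 + fuel = r + (fuel + 1) by ring]
    · intro c hc i hi1 hi2
      have h := hdev c (hsub hc) (i + 1) (by omega) (by omega)
      rw [Fin.sum_univ_succ] at h
      rw [show r + 1 + i = r + (i + 1) by ring]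
      rw [hw c (hsub hc), add_assoc]
      simpa [Fin.tail, add_assoc] using h

theorem exists_rad_le (n : ℕ) {x δ : ℝ} (hx : 0 < x) : ∃ r, 1 ≤ r ∧ rad n r δ ≤ x := by
  have hlog : Filter.Tendsto (fun r : ℕ => Real.log (r : ℝ) / (r : ℝ)) Filter.atTop (nhds 0) :=
    Real.isLittleO_log_id_atTop.tendsto_div_nhds_zero.comp tendsto_natCast_atTop_atTop
  have hinv : Filter.Tendsto (fun r : ℕ => Real.log (4 * n / δ) / (r : ℝ)) Filter.atTop (nhds 0) :=
    tendsto_const_div_atTop_nhds_zero_nat _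
  have h := ((hinv.const_mul (1 / 2)).add hlog).eventually_lt_const (u := x ^ 2) (by
    rw [mul_zero, add_zero]
    positivity)
  obtain ⟨r, hr, hr1⟩ := (h.and (Filter.eventually_ge_atTop 1)).exists
  refine ⟨r, hr1, ?_⟩
  unfold rad
  rw [Real.sqrt_le_left hx.le]
  -- In the degenerate case the convention `Real.log 0 = 0` makes the radius zero. Otherwise its
  -- square is `log (4n/δ) / (2r) + log r / r`, which tends to `0`.
  by_cases hC : 4 * (n : ℝ) / δ = 0
  · rw [show 4 * (n : ℝ) * (r : ℝ) ^ 2 / δ = 4 * n / δ * r ^ 2 by ring, hC]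
    simp only [zero_mul, Real.log_zero, mul_zero]
    positivity
  have hr0 : (0 : ℝ) < r := by exact_mod_cast hr1
  rw [show 4 * (n : ℝ) * (r : ℝ) ^ 2 / δ = 4 * n / δ * r ^ 2 by ring,
    Real.log_mul hC (by positivity), Real.log_pow]
  refine le_of_eq_of_le ?_ hr.le
  push_cast
  field_simp

theorem elimHorizon_spec (n : ℕ) {η : ℝ} (δ : ℝ) (hη : 0 < η) :
    1 ≤ elimHorizon n η δ ∧ rad n (elimHorizon n η δ) δ ≤ η / 4 :=
  Nat.sInf_mem (exists_rad_le n (by positivity))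

theorem sum_inv_sq_le (H : ℕ) : (∑ i ∈ Finset.range H, 1 / ((i + 1 : ℕ) : ℝ) ^ 2) ≤ 2 := by
  -- The term `- 1 / (H + 1)` strengthens the claim enough for a telescoping induction.
  have h : ∀ H : ℕ, (∑ i ∈ Finset.range (H + 1), 1 / ((i + 1 : ℕ) : ℝ) ^ 2) ≤
      2 - 1 / ((H + 1 : ℕ) : ℝ) := by
    intro H
    induction H with
    | zero => norm_num
    | succ H ih =>
      rw [Finset.sum_range_succ]
      have : 1 / ((H + 1 + 1 : ℕ) : ℝ) ^ 2 ≤ 1 / ((H + 1 : ℕ) : ℝ) - 1 / ((H + 1 + 1 : ℕ) : ℝ) := by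
        push_cast
        rw [div_sub_div _ _ (by positivity) (by positivity),
          div_le_div_iff₀ (by positivity) (by positivity)]
        nlinarith [(Nat.cast_nonneg H : (0 : ℝ) ≤ H)]
      linarith
  cases H with
  | zero => norm_num
  | succ H =>
    have h1 := h H
    have h2 : 0 ≤ 1 / ((H + 1 : ℕ) : ℝ) := by positivity
    linarith

/-- The radius is calibrated so that a candidate's Hoeffding bound at round `r` is `δ / (2 n r²)`;
the inverse squares sum to at most `2`, leaving `δ / n` per candidate. -/
theorem exp_rad {n r : ℕ} {δ : ℝ} (hn : 1 ≤ n) (hr : 1 ≤ r) (hδ : 0 < δ) (hδ1 : δ ≤ 1) :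
    2 * Real.exp (-2 * r * rad n r δ ^ 2) = δ / (2 * n) * (1 / (r : ℝ) ^ 2) := by
  have hn' : (1 : ℝ) ≤ n := by exact_mod_cast hn
  have hr' : (1 : ℝ) ≤ r := by exact_mod_cast hr
  have h1 : 1 ≤ 4 * (n : ℝ) * (r : ℝ) ^ 2 / δ := by
    rw [one_le_div hδ]
    nlinarith [mul_le_mul hn' (one_le_pow₀ hr' (n := 2)) zero_le_one (by linarith)]
  unfold rad
  rw [Real.sq_sqrt (mul_nonneg (by positivity) (Real.log_nonneg h1))]
  rw [show -2 * (r : ℝ) * (1 / (2 * r) * Real.log (4 * n * r ^ 2 / δ)) =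
    -Real.log (4 * n * r ^ 2 / δ) by field_simp, Real.exp_neg, Real.exp_log (by positivity)]
  field_simp
  norm_num

/-- With probability at least `1 - δ`, the elimination procedure returns an expert whose conditional
coverage is within `η / 2` of the best candidate. -/
theorem ordinalFailCondElim_good (P : PMF (Ranking m)) (lam : PMF (Fin m)) (sel : SelectionRule m)
    (S : Finset (Fin m)) {A : Finset (Fin m)} (hA : A.Nonempty) {η δ : ℝ} (hη : 0 < η)
    (hδ : 0 < δ) (hδ1 : δ ≤ 1) :
    (ordinalFailCondElim P lam sel S A η δ).toOuterMeasure
      {c | ¬ ∀ a ∈ A, (expect (failedPairLaw P lam S) fun p => (obs a p : ℝ)) - η / 2 ≤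
        expect (failedPairLaw P lam S) fun p => (obs c p : ℝ)} ≤ ENNReal.ofReal δ := by
  set D := failedPairLaw P lam S
  set μ : Fin m → ℝ := fun c => expect D fun p => (obs c p : ℝ)
  set n := A.card
  set H := elimHorizon n η δ
  have hn : 1 ≤ n := Finset.card_pos.2 hA
  obtain ⟨hH1, hH2⟩ := elimHorizon_spec n δ hη
  obtain ⟨c₀, hc₀, hmax⟩ := A.exists_max_image μ hA
  rw [ordinalFailCondElim, elimLoop_eq_map, PMF.toOuterMeasure_map_apply]
  have hsub : (elimPath sel n η δ H 0 A fun _ => 0) ⁻¹'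
      {c | ¬ ∀ a ∈ A, μ a - η / 2 ≤ μ c} ⊆
      ⋃ c ∈ A, ⋃ i ∈ Finset.range H, {v : Fin H → Ranking m × Fin m |
        ((i + 1 : ℕ) : ℝ) * rad n (i + 1) δ ≤
          |(∑ j : Fin H, if (j : ℕ) < i + 1 then (obs c (v j) : ℝ) else 0) -
            ((i + 1 : ℕ) : ℝ) * μ c|} := by
    intro v hv
    by_contra hcon
    simp only [Set.mem_iUnion, Set.mem_ofPred_eq, not_exists, not_le, Finset.mem_range] at hcon
    refine hv fun a ha => ?_
    have h := elimPath_good sel n hη.le δ μ H 0 (A := A) (fun _ => 0) v hH1 (by rwa [zero_add])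
      (fun c hc i hi1 hi2 => by
        obtain ⟨i, rfl⟩ := Nat.exists_eq_add_of_le' hi1
        have := (hcon c hc i (by omega)).le
        simpa using this) hc₀ hmax
    have := hmax a ha
    linarith
  refine (MeasureTheory.measure_mono hsub).trans ?_
  refine (MeasureTheory.measure_biUnion_finset_le _ _).trans ?_
  have hterm : ∀ c ∈ A, (iid D H).toOuterMeasure (⋃ i ∈ Finset.range H,
      {v : Fin H → Ranking m × Fin m | ((i + 1 : ℕ) : ℝ) * rad n (i + 1) δ ≤
          |(∑ j : Fin H, if (j : ℕ) < i + 1 then (obs c (v j) : ℝ) else 0) -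
            ((i + 1 : ℕ) : ℝ) * μ c|}) ≤ ENNReal.ofReal (δ / n) := by
    intro c _
    refine (MeasureTheory.measure_biUnion_finset_le _ _).trans ?_
    calc _ ≤ ∑ i ∈ Finset.range H,
          ENNReal.ofReal (δ / (2 * n) * (1 / ((i + 1 : ℕ) : ℝ) ^ 2)) := by
          refine Finset.sum_le_sum fun i hi => ?_
          rw [← exp_rad hn (Nat.succ_pos i) hδ hδ1]
          exact hoeffding_prefix D (X := fun p => (obs c p : ℝ)) (fun p => Nat.cast_nonneg _)
            (fun p => by exact_mod_cast obs_le_one c p) (Finset.mem_range.1 hi) (Real.sqrt_nonneg _)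
      _ = ENNReal.ofReal (δ / (2 * n) * ∑ i ∈ Finset.range H, 1 / ((i + 1 : ℕ) : ℝ) ^ 2) := by
          rw [Finset.mul_sum, ENNReal.ofReal_sum_of_nonneg]
          intro i _
          positivity
      _ ≤ ENNReal.ofReal (δ / n) := by
          refine ENNReal.ofReal_le_ofReal ?_
          calc _ ≤ δ / (2 * n) * 2 := by
                gcongr
                exact sum_inv_sq_le H
            _ = δ / n := by
                have : (n : ℝ) ≠ 0 := by positivity
                field_simp
  refine (Finset.sum_le_sum hterm).trans ?_
  rw [Finset.sum_const, nsmul_eq_mul, ← ENNReal.ofReal_natCast, ← ENNReal.ofReal_mul (by positivity)]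
  refine ENNReal.ofReal_le_ofReal (le_of_eq ?_)
  have : (n : ℝ) ≠ 0 := by positivity
  exact mul_div_cancel₀ δ this

theorem ordinalFailCondElim_mem (P : PMF (Ranking m)) (lam : PMF (Fin m)) (sel : SelectionRule m)
    (S : Finset (Fin m)) {A : Finset (Fin m)} (hA : A.Nonempty) {η : ℝ} (hη : 0 ≤ η) (δ : ℝ)
    {c : Fin m} (hc : c ∈ (ordinalFailCondElim P lam sel S A η δ).support) : c ∈ A := by
  rw [ordinalFailCondElim, elimLoop_eq_map, PMF.mem_support_map_iff] at hc
  obtain ⟨v, -, rfl⟩ := hc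
  exact elimPath_mem sel _ hη δ _ _ hA _ v

end Elimination

/-! ### Failure rates and the greedy oracle -/

section Greedy

variable {m : ℕ}

theorem pairLaw_apply (P : PMF (Ranking m)) (lam : PMF (Fin m)) (π : Ranking m) (x : Fin m) :
    pairLaw P lam (π, x) = P π * lam x := by
  classical
  rw [pairLaw, PMF.bind_apply, tsum_fintype, Finset.sum_eq_single π]
  · rw [PMF.map_apply, tsum_fintype, Finset.sum_eq_single x]
    · simp
    · intro y _ hy
      simp [hy.symm]
    · simp
  · intro σ _ hσ
    rw [PMF.map_apply, tsum_fintype, Finset.sum_eq_zero, mul_zero]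
    intro y _
    simp [hσ.symm]
  · simp

theorem expect_pairLaw (P : PMF (Ranking m)) (lam : PMF (Fin m)) (f : Ranking m × Fin m → ℝ) :
    expect (pairLaw P lam) f = expect lam fun x => expect P fun π => f (π, x) := by
  unfold expect
  rw [Fintype.sum_prod_type_right]
  refine Finset.sum_congr rfl fun x _ => ?_
  rw [Finset.mul_sum]
  refine Finset.sum_congr rfl fun π _ => ?_
  rw [pairLaw_apply, ENNReal.toReal_mul]
  ring

/-- The probability that a tentative pair fails `S`. -/
def failRate (P : PMF (Ranking m)) (lam : PMF (Fin m)) (S : Finset (Fin m)) : ℝ :=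
  expect (pairLaw P lam) fun p => if Fails S p then 1 else 0

theorem Fails.mono {S T : Finset (Fin m)} (h : S ⊆ T) {p : Ranking m × Fin m} (hT : Fails T p) :
    Fails S p :=
  fun s hs => hT s (h hs)

theorem fails_insert {c : Fin m} {S : Finset (Fin m)} {p : Ranking m × Fin m} :
    Fails (insert c S) p ↔ obs c p = 0 ∧ Fails S p := by
  simp only [Fails, Finset.forall_mem_insert, obs]
  refine and_congr_left fun _ => ?_
  by_cases h1 : c = p.2 <;> by_cases h2 : query p.1 c p.2 = true <;> simp [h1, h2]

theorem not_fails_iff {S : Finset (Fin m)} {p : Ranking m × Fin m} :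
    ¬ Fails S p ↔ ∃ c ∈ S, obs c p = 1 := by
  induction S using Finset.induction_on with
  | empty => simp [Fails]
  | insert c S _ ih =>
    rw [fails_insert, not_and_or, ih]
    have := obs_le_one c p
    simp only [Finset.mem_insert, exists_eq_or_imp]
    exact or_congr_left (by omega)

theorem failRate_anti (P : PMF (Ranking m)) (lam : PMF (Fin m)) {S T : Finset (Fin m)}
    (h : S ⊆ T) : failRate P lam T ≤ failRate P lam S := by
  refine expect_mono _ fun p => ?_
  by_cases hT : Fails T p
  · rw [if_pos hT, if_pos (hT.mono h)]
  · rw [if_neg hT]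
    split_ifs <;> norm_num

theorem failRate_nonneg (P : PMF (Ranking m)) (lam : PMF (Fin m)) (S : Finset (Fin m)) :
    0 ≤ failRate P lam S :=
  expect_nonneg _ fun p => by split_ifs <;> norm_num

theorem failRate_empty (P : PMF (Ranking m)) (lam : PMF (Fin m)) : failRate P lam ∅ = 1 := by
  simp [failRate, Fails, expect_const]

theorem failRate_le_one (P : PMF (Ranking m)) (lam : PMF (Fin m)) (S : Finset (Fin m)) :
    failRate P lam S ≤ 1 :=
  failRate_empty P lam ▸ failRate_anti P lam (Finset.empty_subset S)

/-- Submodularity, checked pair by pair: a pair failing `S` but not `T` is covered by some `c ∈ T`,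
whose marginal contribution is then `1`; all other contributions are nonnegative. -/
theorem failRate_sub_le_sum (P : PMF (Ranking m)) (lam : PMF (Fin m)) (S T : Finset (Fin m)) :
    failRate P lam S - failRate P lam T ≤
      ∑ c ∈ T, (failRate P lam S - failRate P lam (insert c S)) := by
  simp only [failRate, ← expect_sub]
  rw [← expect_sum]
  refine expect_mono _ fun p => ?_
  have hnn : ∀ c ∈ T, (0 : ℝ) ≤
      (if Fails S p then 1 else 0) - (if Fails (insert c S) p then 1 else 0) := by
    intro c _
    by_cases h2 : Fails (insert c S) p
    · rw [if_pos h2, if_pos (h2.mono (Finset.subset_insert c S)), sub_self]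
    · rw [if_neg h2]
      split_ifs <;> norm_num
  by_cases hS : Fails S p
  · by_cases hT : Fails T p
    · rw [if_pos hT, if_pos hS, sub_self]
      simpa only [if_pos hS] using Finset.sum_nonneg hnn
    · obtain ⟨c, hc, hobs⟩ := not_fails_iff.1 hT
      refine le_trans (le_of_eq ?_) (Finset.single_le_sum hnn hc)
      rw [if_neg hT, if_neg fun hc => absurd (fails_insert.1 hc).1 (by omega)]
  · rw [if_neg hS]
    refine le_trans ?_ (Finset.sum_nonneg (by simpa only [if_neg hS] using hnn))
    split_ifs <;> norm_num

/-- Bayes' rule: the mass of failed pairs times the conditional coverage of `c` is the marginal gain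
of `c`. -/
theorem failRate_mul_expect_failedPairLaw (P : PMF (Ranking m)) (lam : PMF (Fin m))
    (S : Finset (Fin m)) (hS : 0 < failRate P lam S) (c : Fin m) :
    (failRate P lam S * expect (failedPairLaw P lam S) fun p => (obs c p : ℝ)) =
      failRate P lam S - failRate P lam (insert c S) := by
  classical
  -- A positive failure rate excludes the junk branch of `failedPairLaw`.
  have hex : ∃ p ∈ {p | Fails S p}, p ∈ (pairLaw P lam).support := by
    by_contra hcon
    push Not at hcon
    refine hS.ne' (Finset.sum_eq_zero fun p _ => ?_)
    by_cases hp : Fails S p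
    · have : pairLaw P lam p = 0 := ((pairLaw P lam).apply_eq_zero_iff p).2 (hcon p hp)
      rw [this, ENNReal.toReal_zero, zero_mul]
    · simp [hp]
  have hZ : (∑' p, Set.indicator {p | Fails S p} (pairLaw P lam) p).toReal = failRate P lam S := by
    rw [← PMF.toOuterMeasure_apply]
    refine (prob_eq_expect (pairLaw P lam) {p | Fails S p}).trans
      (congrArg _ (funext fun p => ?_))
    by_cases hp : Fails S p <;> simp [hp]
  have hlaw : ∀ p, (failedPairLaw P lam S p).toReal =
      (if Fails S p then (pairLaw P lam p).toReal else 0) * (failRate P lam S)⁻¹ := by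
    intro p
    rw [failedPairLaw, dif_pos hex, PMF.filter_apply, ENNReal.toReal_mul, ENNReal.toReal_inv, hZ,
      Set.indicator_apply]
    congr 1
    simp only [Set.mem_ofPred_eq]
    split_ifs <;> simp
  rw [failRate, failRate, ← expect_sub, ← failRate]
  unfold expect
  rw [Finset.mul_sum]
  refine Finset.sum_congr rfl fun p _ => ?_
  rw [hlaw]
  beta_reduce
  have hob := obs_le_one c p
  by_cases h : Fails S p
  · rw [if_pos h, if_pos h]
    have e : (if Fails (insert c S) p then (1 : ℝ) else 0) = 1 - obs c p := by
      rcases (by omega : obs c p = 0 ∨ obs c p = 1) with h0 | h0 <;> simp [fails_insert, h0, h]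
    rw [e]
    field_simp
    ring
  · have h' : ¬ Fails (insert c S) p := fun h' => h (fails_insert.1 h').2
    rw [if_neg h, if_neg h, if_neg h']
    ring

/-! ### Committee sizes and the greedy recursion. -/

theorem subset_padBy (sel : SelectionRule m) (n : ℕ) (S : Finset (Fin m)) : S ⊆ padBy sel n S := by
  induction n generalizing S with
  | zero => exact Finset.Subset.refl S
  | succ n ih => exact (Finset.subset_insert _ _).trans (ih _)

theorem compl_nonempty_of_card_lt {S : Finset (Fin m)} (h : S.card < m) : Sᶜ.Nonempty := by
  rw [← Finset.card_pos, Finset.card_compl, Fintype.card_fin]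
  omega

theorem card_padBy (sel : SelectionRule m) (n : ℕ) (S : Finset (Fin m)) (h : S.card + n ≤ m) :
    (padBy sel n S).card = S.card + n := by
  induction n generalizing S with
  | zero => rfl
  | succ n ih =>
    have hsel := sel.select_mem Sᶜ (compl_nonempty_of_card_lt (by omega))
    have hcard := Finset.card_insert_of_notMem (Finset.mem_compl.1 hsel)
    rw [padBy, ih _ (by omega), hcard]
    ring

theorem card_of_mem_support_greedyLoop (P : PMF (Ranking m)) (lam : PMF (Fin m))
    (sel : SelectionRule m) {k : ℕ} (hk : 1 ≤ k) (hkm : k < m) {ε : ℝ} (hε : 0 < ε) (δ : ℝ)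
    (i : ℕ) {S : Finset (Fin m)} (hS : S.card + i = k) {S' : Finset (Fin m)}
    (hS' : S' ∈ (greedyLoop P lam sel k ε δ i S).support) : S'.card = k := by
  have hk' : (0 : ℝ) < k := by exact_mod_cast hk
  induction i generalizing S with
  | zero =>
    rw [greedyLoop, PMF.mem_support_pure_iff] at hS'
    rw [hS', ← hS, add_zero]
  | succ i ih =>
    rw [greedyLoop, PMF.mem_support_bind_iff] at hS'
    obtain ⟨v, -, hv⟩ := hS'
    dsimp only at hv
    split_ifs at hv with h
    · rw [PMF.mem_support_pure_iff] at hv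
      rw [hv, card_padBy sel _ _ (by omega)]
      omega
    · obtain ⟨c, hc, hS'⟩ := (PMF.mem_support_bind_iff _ _ _).1 hv
      have hcS := ordinalFailCondElim_mem P lam sel S (compl_nonempty_of_card_lt (by omega))
        (div_nonneg hε.le (mul_nonneg (by positivity)
          ((by positivity : 0 ≤ ε / (4 * (k : ℝ))).trans (not_le.1 h).le))) _ hc
      refine ih ?_ hS'
      rw [Finset.card_insert_of_notMem (Finset.mem_compl.1 hcS)]
      omega

/-- Here `128 = 16² / 2`: the sample size cancels the accuracy `ε / (16k)` in Hoeffding's exponent.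
-/
theorem two_mul_exp_numTentative_le {k : ℕ} (hk : 1 ≤ k) {ε δ : ℝ} (hε : 0 < ε) (hδ : 0 < δ) :
    2 * Real.exp (-2 * (numTentative k ε δ : ℝ) * (ε / (16 * k)) ^ 2) ≤ δ / (2 * k) := by
  have hk' : (0 : ℝ) < k := by exact_mod_cast hk
  have h1 : 128 * (k : ℝ) ^ 2 / ε ^ 2 * Real.log (4 * k / δ) ≤ numTentative k ε δ := Nat.le_ceil _
  have h2 : -2 * (numTentative k ε δ : ℝ) * (ε / (16 * k)) ^ 2 ≤ -Real.log (4 * k / δ) := by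
    have h3 := mul_le_mul_of_nonneg_right h1 (by positivity : 0 ≤ 2 * (ε / (16 * k)) ^ 2)
    have h4 : 128 * (k : ℝ) ^ 2 / ε ^ 2 * Real.log (4 * k / δ) * (2 * (ε / (16 * k)) ^ 2) =
        Real.log (4 * k / δ) := by
      field_simp
      ring
    linarith
  calc _ ≤ 2 * Real.exp (-Real.log (4 * k / δ)) := by gcongr
    _ = δ / (2 * k) := by
      rw [Real.exp_neg, Real.exp_log (by positivity)]
      field_simp
      norm_num

/-- The gap `d` to the comparator obeys `d ↦ (1 - 1/k) d + ε/(8k)` per iteration; the extra `ε / 4`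
pays for early stopping. Each iteration spends `δ/(2k)` on estimating the failure rate and `δ/(2k)`
on elimination. -/
theorem greedyLoop_good (P : PMF (Ranking m)) (lam : PMF (Fin m)) (sel : SelectionRule m)
    {k : ℕ} (hk : 1 ≤ k) (hkm : k < m) {ε δ : ℝ} (hε : 0 < ε) (hδ : 0 < δ) (hδ1 : δ ≤ 1)
    {T : Finset (Fin m)} (hT : T.card = k) (i : ℕ) {S : Finset (Fin m)} (hS : S.card + i = k)
    {d : ℝ} (hd : 0 ≤ d) (hSd : failRate P lam S - failRate P lam T ≤ d) :
    (greedyLoop P lam sel k ε δ i S).toOuterMeasure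
      {S' | ¬ failRate P lam S' - failRate P lam T ≤
        (1 - 1 / (k : ℝ)) ^ i * d + i * (ε / (8 * k)) + ε / 4} ≤ ENNReal.ofReal (i * (δ / k)) := by
  have hk' : (1 : ℝ) ≤ k := by exact_mod_cast hk
  have hk0 : (0 : ℝ) < k := by linarith
  have hk1 : 0 ≤ 1 - 1 / (k : ℝ) := by
    rw [sub_nonneg, div_le_one hk0]
    exact hk'
  induction i generalizing S d with
  | zero =>
    rw [greedyLoop, PMF.toOuterMeasure_pure_apply, if_neg]
    · exact zero_le
    · simp only [Set.mem_ofPred_eq, not_not, pow_zero, one_mul, Nat.cast_zero, zero_mul, add_zero]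
      linarith
  | succ i ih =>
    have hsplit : ENNReal.ofReal (((i + 1 : ℕ) : ℝ) * (δ / k)) =
        ENNReal.ofReal (δ / (2 * k)) + (ENNReal.ofReal (δ / (2 * k)) +
          ENNReal.ofReal (i * (δ / k))) := by
      rw [← ENNReal.ofReal_add (by positivity) (by positivity),
        ← ENNReal.ofReal_add (by positivity) (by positivity)]
      congr 1
      push_cast
      field_simp
      ring
    rw [greedyLoop, hsplit]
    refine toOuterMeasure_bind_le
      ((hoeffding (pairLaw P lam) (X := fun p => if Fails S p then 1 else 0)
        (fun p => by split_ifs <;> norm_num) (fun p => by split_ifs <;> norm_num)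
        (numTentative k ε δ)
        (t := ε / (16 * k)) (by positivity)).trans
        (ENNReal.ofReal_le_ofReal (two_mul_exp_numTentative_le hk hε hδ))) ?_
    intro v _ hv
    rw [Set.mem_ofPred_eq, not_le, ← failRate] at hv
    set f := failRate P lam S with hf
    -- With no samples, the strict deviation bound would read `|·| < 0`.
    have hN0 : (0 : ℝ) < numTentative k ε δ := by
      refine lt_of_le_of_ne (Nat.cast_nonneg _) fun h0 => ?_
      rw [← h0] at hv
      exact absurd (hv.trans_le (zero_mul _).le) (not_lt.2 (abs_nonneg _))
    have hρ : |((Finset.univ.filter fun j => Fails S (v j)).card : ℝ) / (numTentative k ε δ : ℝ) - f| <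
        ε / (16 * k) := by
      rw [Finset.sum_boole] at hv
      have e : ((Finset.univ.filter fun j => Fails S (v j)).card : ℝ) / (numTentative k ε δ : ℝ) - f =
          (((Finset.univ.filter fun j => Fails S (v j)).card : ℝ) -
            numTentative k ε δ * f) / numTentative k ε δ := by
        field_simp
      rw [e, abs_div, abs_of_pos hN0, div_lt_iff₀ hN0, mul_comm _ (numTentative k ε δ : ℝ)]
      exact hv
    clear_value f
    dsimp only
    set ρhat := ((Finset.univ.filter fun j => Fails S (v j)).card : ℝ) / (numTentative k ε δ : ℝ)
    set ρbar := min 1 (ρhat + ε / (16 * k)) with hρbar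
    obtain ⟨hρ1, hρ2⟩ := abs_lt.1 hρ
    have hf1 : f ≤ 1 := hf ▸ failRate_le_one P lam S
    -- The estimate is shifted upward so that it dominates the true failure rate, and still exceeds
    -- it by at most `ε / (8k)`.
    have hle : f ≤ ρbar := le_min hf1 (by linarith)
    have hge : ρbar ≤ f + ε / (8 * k) := by
      refine (min_le_right _ _).trans ?_
      have : ε / (8 * k) = ε / (16 * k) + ε / (16 * k) := by
        field_simp
        norm_num
      linarith
    clear_value ρhat ρbar
    have hquarter : ε / (4 * k) = ε / (8 * k) + ε / (8 * k) := by
      field_simp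
      norm_num
    split_ifs with hsmall
    · refine le_of_eq_of_le (toOuterMeasure_eq_zero ?_) zero_le
      intro S' hS'
      rw [PMF.mem_support_pure_iff] at hS'
      subst hS'
      rw [Set.mem_ofPred_eq, not_not]
      have h1 := failRate_anti P lam (subset_padBy sel (k - S.card) S)
      have h2 := failRate_nonneg P lam T
      have h3 : ε / (4 * k) ≤ ε / 4 := by
        gcongr
        linarith
      have h4 : 0 ≤ (1 - 1 / (k : ℝ)) ^ (i + 1) * d + ((i + 1 : ℕ) : ℝ) * (ε / (8 * k)) := by
        positivity
      linarith
    · have hpos : 0 < ρbar := lt_of_le_of_lt (by positivity) (not_le.1 hsmall)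
      have hfpos : 0 < f := by
        have : 0 < ε / (8 * k) := by positivity
        linarith [not_le.1 hsmall]
      have hA : Sᶜ.Nonempty := compl_nonempty_of_card_lt (by omega)
      have hη : 0 < ε / (4 * k * ρbar) := by positivity
      refine toOuterMeasure_bind_le (ordinalFailCondElim_good P lam sel S hA hη
        (δ := δ / (2 * k)) (by positivity) ?_) ?_
      · rw [div_le_one (by positivity)]
        linarith
      intro c hc hgood
      rw [Set.mem_ofPred_eq, not_not] at hgood
      have hcS := ordinalFailCondElim_mem P lam sel S hA hη.le _ hc
      have hcard : (insert c S).card + i = k := by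
        rw [Finset.card_insert_of_notMem (Finset.mem_compl.1 hcS)]
        omega
      -- Conditional suboptimality `η' / 2` becomes `ε / (8k)` in unconditional gain, because `f ≤
      -- ρbar`.
      have hfη : f * (ε / (4 * k * ρbar) / 2) ≤ ε / (8 * k) := by
        calc _ ≤ ρbar * (ε / (4 * k * ρbar) / 2) := by gcongr
          _ = ε / (8 * k) := by
            field_simp
            norm_num
      have hgain : ∀ a ∈ T, f - failRate P lam (insert a S) ≤
          f - failRate P lam (insert c S) + ε / (8 * k) := by
        intro a _
        -- Elimination ranks only candidates outside `S`; members of `T` already in `S` have zero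
        -- gain.
        by_cases ha : a ∈ S
        · rw [Finset.insert_eq_of_mem ha, ← hf, sub_self]
          have h1 := failRate_anti P lam (Finset.subset_insert c S)
          have : 0 < ε / (8 * k) := by positivity
          linarith
        · have h1 := failRate_mul_expect_failedPairLaw P lam S (hf ▸ hfpos) a
          have h2 := failRate_mul_expect_failedPairLaw P lam S (hf ▸ hfpos) c
          rw [← hf] at h1 h2
          have h3 := mul_le_mul_of_nonneg_left (hgood a (Finset.mem_compl.2 ha)) hfpos.le
          rw [mul_sub, h1, h2] at h3
          linarith
      have hsum : f - failRate P lam T ≤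
          k * (f - failRate P lam (insert c S) + ε / (8 * k)) := by
        have h1 := failRate_sub_le_sum P lam S T
        rw [← hf] at h1
        refine h1.trans ((Finset.sum_le_sum hgain).trans (le_of_eq ?_))
        rw [Finset.sum_const, hT, nsmul_eq_mul]
      have hstep : failRate P lam (insert c S) - failRate P lam T ≤
          (1 - 1 / (k : ℝ)) * d + ε / (8 * k) := by
        have h1 : (f - failRate P lam T) / k ≤ f - failRate P lam (insert c S) + ε / (8 * k) := by
          rw [div_le_iff₀ hk0, mul_comm _ (k : ℝ)]
          exact hsum
        have h2 := mul_le_mul_of_nonneg_left hSd hk1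
        have h3 : (1 - 1 / (k : ℝ)) * (f - failRate P lam T) =
          (f - failRate P lam T) - (f - failRate P lam T) / k := by ring
        linarith
      refine (MeasureTheory.measure_mono ?_).trans (ih hcard (by positivity) hstep)
      intro S' hS' hcon
      refine hS' (hcon.trans ?_)
      have h1 : (1 - 1 / (k : ℝ)) ^ i * (ε / (8 * k)) ≤ ε / (8 * k) := by
        refine mul_le_of_le_one_left (by positivity) (pow_le_one₀ hk1 ?_)
        rw [sub_le_self_iff]
        positivity
      have h2 : (1 - 1 / (k : ℝ)) ^ i * ((1 - 1 / (k : ℝ)) * d + ε / (8 * k)) =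
        (1 - 1 / (k : ℝ)) ^ (i + 1) * d + (1 - 1 / (k : ℝ)) ^ i * (ε / (8 * k)) := by ring
      rw [h2]
      push_cast
      linarith

/-! ### Coverage and win rates -/

theorem query_eq_true_iff {π : Ranking m} {a b : Fin m} :
    query π a b = true ↔ rank π a < rank π b :=
  decide_eq_true_iff

theorem obs_eq_one_iff {c x : Fin m} {π : Ranking m} :
    obs c (π, x) = 1 ↔ rank π c ≤ rank π x := by
  have h : c = x ↔ (π c : ℕ) = π x := by
    rw [← Fin.ext_iff, π.injective.eq_iff]
  simp only [obs, query_eq_true_iff, rank, h]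
  split_ifs <;> simp <;> omega

theorem not_fails_iff_prefix {S : Finset (Fin m)} {π : Ranking m} {x : Fin m} :
    ¬ Fails S (π, x) ↔ (S ∩ prefixUpTo π x).Nonempty := by
  simp only [not_fails_iff, obs_eq_one_iff, Finset.Nonempty, Finset.mem_inter, prefixUpTo,
    Finset.mem_filter_univ]

theorem g_eq_expect (P : PMF (Ranking m)) (x : Fin m) (S : Finset (Fin m)) :
    g P x S = expect P fun π => if Fails S (π, x) then 0 else 1 := by
  classical
  rw [g, prob_eq_expect]
  congr 1
  funext π
  by_cases h : Fails S (π, x) <;> simp [← not_fails_iff_prefix, h]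

theorem expect_g (P : PMF (Ranking m)) (lam : PMF (Fin m)) (S : Finset (Fin m)) :
    (expect lam fun x => g P x S) = 1 - failRate P lam S := by
  have h : 1 - failRate P lam S = expect (pairLaw P lam) fun p => 1 - if Fails S p then 1 else 0 := by
    rw [expect_sub, expect_const, failRate]
  rw [h, expect_pairLaw]
  congr 1
  funext x
  rw [g_eq_expect]
  congr 1
  funext π
  split_ifs <;> norm_num

theorem g_mono (P : PMF (Ranking m)) (x : Fin m) {S T : Finset (Fin m)} (h : S ⊆ T) :
    g P x S ≤ g P x T := by
  rw [g_eq_expect, g_eq_expect]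
  refine expect_mono _ fun π => ?_
  by_cases hT : Fails T (π, x)
  · rw [if_pos hT, if_pos (hT.mono h)]
  · rw [if_neg hT]
    split_ifs <;> norm_num

theorem g_eq_one (P : PMF (Ranking m)) {x : Fin m} {S : Finset (Fin m)} (h : x ∈ S) :
    g P x S = 1 := by
  rw [g_eq_expect]
  refine Eq.trans (congrArg _ (funext fun π => ?_)) (expect_const P 1)
  rw [if_neg fun hf => (hf x h).1 rfl]

theorem g_le_one (P : PMF (Ranking m)) (x : Fin m) (S : Finset (Fin m)) : g P x S ≤ 1 := by
  rw [g_eq_expect]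
  exact (expect_mono _ fun π => by split_ifs <;> norm_num).trans (expect_const P 1).le

/-- Outside `S` there are no ties, so the half credit vanishes; the empty committee's rank `m + 1`
loses to everyone. -/
theorem win_singleton (P : PMF (Ranking m)) {x : Fin m} {S : Finset (Fin m)} (h : x ∉ S) :
    win P S {x} = g P x S := by
  rw [g_eq_expect, win]
  congr 1
  funext π
  have hx : bestRank π {x} = rank π x := by simp [bestRank]
  have hlt : bestRank π S < rank π x ↔ ¬ Fails S (π, x) := by
    have hxm : rank π x ≤ m := (π x).isLt
    rw [bestRank]
    split_ifs with hS
    · rw [Finset.inf'_lt_iff]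
      simp only [Fails, query, decide_eq_false_iff_not, not_forall, exists_prop, not_and_or, not_not]
      refine exists_congr fun c => and_congr_right fun hc => ?_
      have : c ≠ x := fun e => h (e ▸ hc)
      simp [this]
    · rw [Finset.not_nonempty_iff_eq_empty.1 hS]
      simp [Fails]
      omega
  have hne : bestRank π S ≠ rank π x := by
    have hxm : rank π x ≤ m := (π x).isLt
    rw [bestRank]
    split_ifs with hS
    · obtain ⟨c, hc, hcS⟩ := Finset.exists_mem_eq_inf' hS (rank π)
      rw [hcS]
      intro e
      have : c = x := π.injective (Fin.ext (Nat.succ_injective e))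
      exact h (this ▸ hc)
    · omega
  rw [hx, if_neg hne]
  by_cases hf : Fails S (π, x)
  · rw [if_neg fun h' => hlt.1 h' hf, if_pos hf]
    norm_num
  · rw [if_pos (hlt.2 hf), if_neg hf]
    norm_num

theorem theta_le_g (P : PMF (Ranking m)) (x : Fin m) {S : Finset (Fin m)} (hS : S.card < m) :
    theta P S ≤ g P x S := by
  have hne := compl_nonempty_of_card_lt hS
  rw [theta, dif_pos hne]
  by_cases hx : x ∈ S
  · rw [g_eq_one P hx]
    obtain ⟨y, hy⟩ := hne
    exact (Finset.inf'_le _ hy).trans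
      ((win_singleton P (Finset.mem_compl.1 hy)).le.trans (g_le_one P y S))
  · exact (Finset.inf'_le _ (Finset.mem_compl.2 hx)).trans (win_singleton P hx).le

/-- The comparator is chosen before any rival law, so it can be used in every round. Members of `T`
are covered with probability one. -/
theorem exists_card_eq_thetaStar_le_g (P : PMF (Ranking m)) {k : ℕ} (hkm : k < m) :
    ∃ T : Finset (Fin m), T.card = k ∧ ∀ x, thetaStar P k ≤ g P x T := by
  have hne : (Finset.powersetCard k (Finset.univ : Finset (Fin m))).Nonempty :=
    Finset.powersetCard_nonempty.2 (by simpa using hkm.le)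
  obtain ⟨T, hT, hTeq⟩ := Finset.exists_mem_eq_sup' hne (theta P)
  have hcard := (Finset.mem_powersetCard.1 hT).2
  refine ⟨T, hcard, fun x => ?_⟩
  rw [thetaStar, dif_pos hne, hTeq]
  exact theta_le_g P x (hcard ▸ hkm)

theorem thetaStar_le_one (P : PMF (Ranking m)) {k : ℕ} (hkm : k < m) : thetaStar P k ≤ 1 := by
  obtain ⟨T, -, hT⟩ := exists_card_eq_thetaStar_le_g P hkm
  exact (hT ⟨k, hkm⟩).trans (g_le_one _ _ _)

theorem one_sub_exp_neg_one_nonneg : 0 ≤ 1 - 1 / Real.exp 1 := by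
  rw [sub_nonneg, div_le_one (Real.exp_pos _)]
  exact Real.one_le_exp zero_le_one

/-- The guarantee of the fixed-weight oracle. -/
theorem fixedWeightOracle_good (P : PMF (Ranking m)) (sel : SelectionRule m) {k : ℕ} (hk : 1 ≤ k)
    (hkm : k < m) (lam : PMF (Fin m)) {ε δ : ℝ} (hε : 0 < ε) (hδ : 0 < δ) (hδ1 : δ ≤ 1) :
    (fixedWeightOracle P sel k lam ε δ).toOuterMeasure
      {S | ¬ (1 - 1 / Real.exp 1) * thetaStar P k - ε ≤ expect lam fun x => g P x S} ≤
        ENNReal.ofReal δ := by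
  obtain ⟨T, hTcard, hT⟩ := exists_card_eq_thetaStar_le_g P hkm
  have hk' : (1 : ℝ) ≤ k := by exact_mod_cast hk
  have hk0 : (k : ℝ) ≠ 0 := by linarith
  have hTF : thetaStar P k ≤ 1 - failRate P lam T := by
    rw [← expect_g, ← expect_const lam (thetaStar P k)]
    exact expect_mono _ hT
  have hd : 0 ≤ 1 - failRate P lam T := sub_nonneg.2 (failRate_le_one P lam T)
  -- The empty committee always fails, so the initial gap is exactly the coverage of `T`. The errors
  -- add up to `ε/8 + ε/4`.
  have h := greedyLoop_good P lam sel hk hkm hε hδ hδ1 hTcard k (S := ∅) (by simp) hd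
    (by rw [failRate_empty])
  rw [mul_div_cancel₀ δ hk0] at h
  refine (MeasureTheory.measure_mono ?_).trans h
  intro S hS hcon
  refine hS ?_
  rw [expect_g]
  have hpow : (1 - 1 / (k : ℝ)) ^ k ≤ 1 / Real.exp 1 := by
    have := Real.one_sub_div_pow_le_exp_neg (n := k) (t := 1) hk'
    rwa [Real.exp_neg, ← one_div] at this
  have h1 := mul_le_mul_of_nonneg_right hpow hd
  have h2 := mul_le_mul_of_nonneg_left hTF one_sub_exp_neg_one_nonneg
  have h3 : (k : ℝ) * (ε / (8 * k)) = ε / 8 := by field_simp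
  rw [h3] at hcon
  linarith

end Greedy

/-! ### Audits -/

section Audit

variable {m : ℕ}

theorem run_findTop {β : Type} (π : Ranking m) (cur : Fin m) (l : List (Fin m))
    (next : Fin m → CompTree m β) :
    ∃ s ∈ cur :: l, (∀ c ∈ cur :: l, rank π s ≤ rank π c) ∧
      (findTop cur l next).run π = (((next s).run π).1, ((next s).run π).2 + l.length) := by
  induction l generalizing cur with
  | nil => exact ⟨cur, by simp, by simp, rfl⟩
  | cons a l ih =>
    obtain ⟨s, hs, hbest, hrun⟩ := ih (if query π a cur then a else cur)
    have hrun' : (findTop cur (a :: l) next).run π =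
        (((next s).run π).1, ((next s).run π).2 + (a :: l).length) := by
      rw [findTop, CompTree.run, hrun]
      rfl
    refine ⟨s, ?_, ?_, hrun'⟩
    · simp only [List.mem_cons] at hs ⊢
      split_ifs at hs <;> tauto
    · simp only [List.mem_cons, forall_eq_or_imp] at hbest ⊢
      refine ⟨?_, ?_, hbest.2⟩
      all_goals
        have h := hbest.1
        have hq := query_eq_true_iff (π := π) (a := a) (b := cur)
        split_ifs at h with h1
        · have := hq.1 h1
          omega
        · have := mt hq.2 h1
          omega

theorem run_compareAll (π : Ranking m) (s : Fin m) (l : List (Fin m)) (acc : Finset (Fin m)) :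
    ((compareAll s l acc).run π).2 = l.length ∧
      ∀ x, x ∈ ((compareAll s l acc).run π).1 ↔ x ∈ acc ∨ x ∈ l ∧ rank π s < rank π x := by
  induction l generalizing acc with
  | nil => exact ⟨rfl, by simp [compareAll, CompTree.run]⟩
  | cons a l ih =>
    obtain ⟨h1, h2⟩ := ih (if query π s a then insert a acc else acc)
    refine ⟨?_, fun x => ?_⟩
    · rw [compareAll, CompTree.run, h1]
      rfl
    · rw [compareAll, CompTree.run]
      refine (h2 x).trans ?_
      have hq := query_eq_true_iff (π := π) (a := s) (b := a)
      by_cases h : query π s a = true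
      · have hlt := hq.1 h
        rw [if_pos h, Finset.mem_insert, List.mem_cons]
        constructor
        · rintro ((rfl | h') | h')
          · exact Or.inr ⟨Or.inl rfl, hlt⟩
          · exact Or.inl h'
          · exact Or.inr ⟨Or.inr h'.1, h'.2⟩
        · rintro (h' | ⟨rfl | h', h3⟩)
          · exact Or.inl (Or.inr h')
          · exact Or.inl (Or.inl rfl)
          · exact Or.inr ⟨h', h3⟩
      · have hlt := mt hq.2 h
        rw [if_neg h, List.mem_cons]
        constructor
        · rintro (h' | h')
          · exact Or.inl h'
          · exact Or.inr ⟨Or.inr h'.1, h'.2⟩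
        · rintro (h' | ⟨rfl | h', h3⟩)
          · exact Or.inl h'
          · exact absurd h3 hlt
          · exact Or.inr ⟨h', h3⟩

/-- A nonempty `S` costs `|S| - 1` comparisons to find its best member and `m - |S|` to test it.
That member beats `x ∉ S` exactly when some member of `S` does. -/
theorem run_auditTask (π : Ranking m) (S : Finset (Fin m)) :
    ((auditTask S).run π).2 ≤ m ∧
      ∀ x ∉ S, (x ∈ ((auditTask S).run π).1 ↔ ¬ Fails S (π, x)) := by
  have hmem : ∀ x, x ∈ S.toList ↔ x ∈ S := fun x => Finset.mem_toList
  have hlen : S.toList.length = S.card := Finset.length_toList S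
  have hclen : Sᶜ.toList.length = Sᶜ.card := Finset.length_toList _
  have hsum : S.card + Sᶜ.card = m := by simp
  unfold auditTask
  split
  next h =>
    have hS : S = ∅ := by simpa using h
    simp [CompTree.run, hS, Fails]
  next a l h =>
    rw [h] at hmem hlen
    obtain ⟨s, hs, hbest, hrun⟩ := run_findTop π a l fun s => compareAll s Sᶜ.toList ∅
    obtain ⟨hcost, hres⟩ := run_compareAll π s Sᶜ.toList ∅
    rw [hrun]
    constructor
    · rw [List.length_cons] at hlen
      dsimp only
      omega
    · intro x hx
      dsimp only
      rw [hres, not_fails_iff]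
      have hne : ∀ c ∈ S, rank π c ≠ rank π x := by
        intro c hc e
        have : c = x := π.injective (Fin.ext (Nat.succ_injective e))
        exact hx (this ▸ hc)
      simp only [Finset.notMem_empty, false_or, Finset.mem_toList, Finset.mem_compl, obs_eq_one_iff]
      constructor
      · rintro ⟨-, h'⟩
        exact ⟨s, (hmem s).1 hs, h'.le⟩
      · rintro ⟨c, hc, h'⟩
        have := hbest c ((hmem c).2 hc)
        have := hne c hc
        exact ⟨hx, by omega⟩

theorem gHat_nonneg {T : ℕ} (S : Finset (Fin m)) (v : Fin T → Ranking m) (x : Fin m) :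
    0 ≤ gHat S v x := by
  unfold gHat
  split_ifs <;> positivity

theorem gHat_le_one {T : ℕ} (S : Finset (Fin m)) (v : Fin T → Ranking m) (x : Fin m) :
    gHat S v x ≤ 1 := by
  unfold gHat
  split_ifs
  · exact le_rfl
  · refine div_le_one_of_le₀ ?_ (Nat.cast_nonneg T)
    exact_mod_cast (Finset.card_le_univ _).trans (Fintype.card_fin T).le

theorem gHat_eq_sum_div {T : ℕ} {S : Finset (Fin m)} (v : Fin T → Ranking m) {x : Fin m}
    (hx : x ∉ S) : gHat S v x = (∑ j, if Fails S (v j, x) then (0 : ℝ) else 1) / T := by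
  rw [gHat, if_neg hx, ← Finset.sum_boole]
  congr 1
  refine Finset.sum_congr rfl fun j _ => ?_
  have h := (run_auditTask (v j) S).2 x hx
  by_cases hf : Fails S (v j, x)
  · rw [if_pos hf, if_neg fun h' => h.1 h' hf]
  · rw [if_neg hf, if_pos (h.2 hf)]

theorem audit_good (P : PMF (Ranking m)) (S : Finset (Fin m)) {T : ℕ} (hT : 0 < T) {a : ℝ}
    (ha : 0 ≤ a) :
    (iid P T).toOuterMeasure {v | ¬ ∀ x, |gHat S v x - g P x S| ≤ a} ≤
      ENNReal.ofReal (m * (2 * Real.exp (-2 * T * a ^ 2))) := by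
  have hT' : (0 : ℝ) < T := by exact_mod_cast hT
  have hsub : {v : Fin T → Ranking m | ¬ ∀ x, |gHat S v x - g P x S| ≤ a} ⊆
      ⋃ x ∈ (Finset.univ : Finset (Fin m)), {v : Fin T → Ranking m | T * a ≤
        |(∑ j, if Fails S (v j, x) then (0 : ℝ) else 1) -
          T * expect P fun π => if Fails S (π, x) then 0 else 1|} := by
    intro v hv
    by_contra hcon
    simp only [Set.mem_iUnion, Set.mem_ofPred_eq, not_exists, not_le] at hcon
    refine hv fun x => ?_
    -- For members both quantities equal `1`; only outside experts need concentration.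
    by_cases hx : x ∈ S
    · rw [gHat, if_pos hx, g_eq_one P hx, sub_self, abs_zero]
      exact ha
    · have h := hcon x (Finset.mem_univ x)
      rw [← g_eq_expect] at h
      rw [gHat_eq_sum_div v hx]
      have e : ∀ y : ℝ, y / T - g P x S = (y - T * g P x S) / T := by
        intro y
        field_simp
      rw [e, abs_div, abs_of_pos hT', div_le_iff₀ hT', mul_comm a]
      exact h.le
  refine (MeasureTheory.measure_mono hsub).trans ?_
  refine (MeasureTheory.measure_biUnion_finset_le _ _).trans ?_
  refine (Finset.sum_le_sum fun x _ => hoeffding P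
    (X := fun π => if Fails S (π, x) then 0 else 1) (fun π => by split_ifs <;> norm_num)
    (fun π => by split_ifs <;> norm_num) T ha).trans (le_of_eq ?_)
  rw [Finset.sum_const, Finset.card_univ, Fintype.card_fin, nsmul_eq_mul,
    ENNReal.ofReal_mul (Nat.cast_nonneg m), ENNReal.ofReal_natCast]

end Audit

/-! ### The minimax wrapper -/

section Wrapper

variable {m : ℕ} [NeZero m]

theorem sum_exp_mul_expect_mwDist (η : ℝ) (G f : Fin m → ℝ) :
    (∑ x, Real.exp (η * G x)) * expect (mwDist η G) f = ∑ x, Real.exp (η * G x) * f x := by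
  have hpos : 0 < ∑ x, Real.exp (η * G x) :=
    Finset.sum_pos (fun x _ => Real.exp_pos _) ⟨0, Finset.mem_univ _⟩
  unfold expect
  rw [Finset.mul_sum]
  refine Finset.sum_congr rfl fun x _ => ?_
  rw [mwDist, PMF.normalize_apply, tsum_fintype, ENNReal.toReal_mul, ENNReal.toReal_inv,
    ← ENNReal.ofReal_sum_of_nonneg fun _ _ => Real.exp_nonneg _, ENNReal.toReal_ofReal hpos.le,
    ENNReal.toReal_ofReal (Real.exp_nonneg _)]
  field_simp

/-- One multiplicative-weights update of the exponential potential. -/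
theorem sum_exp_update_le {η c : ℝ} (hη : 0 ≤ η) (hη1 : η ≤ 1) (G f : Fin m → ℝ)
    (hf0 : ∀ x, 0 ≤ f x) (hf1 : ∀ x, f x ≤ 1) (hc : expect (mwDist η G) f ≤ c) :
    ∑ x, Real.exp (η * (G x + f x)) ≤
      (∑ x, Real.exp (η * G x)) * Real.exp (η * c + η ^ 2) := by
  have hpos : 0 ≤ ∑ x, Real.exp (η * G x) := Finset.sum_nonneg fun x _ => Real.exp_nonneg _
  calc ∑ x, Real.exp (η * (G x + f x))
      ≤ ∑ x, (Real.exp (η * G x) * (1 + η ^ 2) + η * (Real.exp (η * G x) * f x)) := by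
        refine Finset.sum_le_sum fun x _ => ?_
        have hx0 : 0 ≤ η * f x := mul_nonneg hη (hf0 x)
        have hxη : η * f x ≤ η := mul_le_of_le_one_right hη (hf1 x)
        -- The estimate is `exp y ≤ 1 + y + y²` at `y = η * f x ∈ [0, 1]`.
        have h := (abs_le.1 (Real.abs_exp_sub_one_sub_id_le
          (abs_le.2 ⟨by linarith, hxη.trans hη1⟩))).2
        have h2 : (η * f x) ^ 2 ≤ η ^ 2 := pow_le_pow_left₀ hx0 hxη 2
        have h3 : Real.exp (η * f x) ≤ 1 + η ^ 2 + η * f x := by linarith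
        rw [mul_add, Real.exp_add]
        calc _ ≤ Real.exp (η * G x) * (1 + η ^ 2 + η * f x) := by gcongr
          _ = _ := by ring
    _ = (∑ x, Real.exp (η * G x)) * (1 + η ^ 2 + η * expect (mwDist η G) f) := by
        rw [Finset.sum_add_distrib, ← Finset.sum_mul, ← Finset.mul_sum,
          ← sum_exp_mul_expect_mwDist]
        ring
    _ ≤ (∑ x, Real.exp (η * G x)) * Real.exp (η * c + η ^ 2) := by
        gcongr
        have h1 := Real.add_one_le_exp (η * c + η ^ 2)
        have h2 := mul_le_mul_of_nonneg_left hc hη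
        linarith

/-- The state after `t` rounds is good: the audited gains dominate the violations up to `a` per
round, and the exponential potential has grown at the rate of average gain `c`. -/
def WrapperState.IsGood {t : ℕ} (P : PMF (Ranking m)) (η a c : ℝ) (s : WrapperState m t) : Prop :=
  (∀ x, ∑ j, (1 - g P x (s.committees j)) ≤ s.gain x + t * a) ∧
    ∑ x, Real.exp (η * s.gain x) ≤ m * Real.exp (t * (η * c + η ^ 2))

/-- The audit is used in both directions: `ĝ ≤ g + a` makes audited gains dominate true violations,
and `g ≤ ĝ + a` transfers the oracle's average coverage to the gains driving the potential. -/
theorem wrapperRound_good (P : PMF (Ranking m)) (sel : SelectionRule m) {k : ℕ} (hk : 1 ≤ k)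
    (hkm : k < m) {ε' δ' a η b : ℝ} (hε : 0 < ε') (hδ : 0 < δ') (hδ1 : δ' ≤ 1) (ha : 0 ≤ a)
    (hη : 0 ≤ η) (hη1 : η ≤ 1) {T : ℕ} (hT : 0 < T)
    (hTb : m * (2 * Real.exp (-2 * T * a ^ 2)) ≤ b) {t : ℕ} {s : WrapperState m t}
    (hs : s.IsGood P η a (1 - ((1 - 1 / Real.exp 1) * thetaStar P k - ε') + a)) :
    (wrapperRound P sel k ε' δ' T η s).toOuterMeasure
      {s' | ¬ s'.IsGood P η a (1 - ((1 - 1 / Real.exp 1) * thetaStar P k - ε') + a)} ≤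
        ENNReal.ofReal δ' + ENNReal.ofReal b := by
  rw [wrapperRound]
  refine toOuterMeasure_bind_le
    (fixedWeightOracle_good P sel hk hkm (mwDist η s.gain) hε hδ hδ1) ?_
  intro S _ hS
  rw [Set.mem_ofPred_eq, not_not] at hS
  rw [PMF.toOuterMeasure_map_apply]
  refine (MeasureTheory.measure_mono ?_).trans
    ((audit_good P S hT ha).trans (ENNReal.ofReal_le_ofReal hTb))
  intro v hv haudit
  refine hv ⟨fun x => ?_, ?_⟩
  · rw [Fin.sum_univ_castSucc]
    simp only [Fin.snoc_castSucc, Fin.snoc_last]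
    have h1 := hs.1 x
    have h2 := (abs_le.1 (haudit x)).2
    push_cast
    linarith
  · have hc : (expect (mwDist η s.gain) fun x => 1 - gHat S v x) ≤
        1 - ((1 - 1 / Real.exp 1) * thetaStar P k - ε') + a := by
      calc _ ≤ expect (mwDist η s.gain) fun x => 1 + a - g P x S := by
            refine expect_mono _ fun x => ?_
            have := (abs_le.1 (haudit x)).1
            linarith
        _ = 1 + a - expect (mwDist η s.gain) fun x => g P x S := by
            rw [expect_sub, expect_const]
        _ ≤ _ := by linarith
    refine (sum_exp_update_le hη hη1 s.gain (fun x => 1 - gHat S v x)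
      (fun x => sub_nonneg.2 (gHat_le_one S v x)) (fun x => sub_le_self _ (gHat_nonneg S v x))
      hc).trans ?_
    refine (mul_le_mul_of_nonneg_right hs.2 (Real.exp_nonneg _)).trans (le_of_eq ?_)
    rw [mul_assoc, ← Real.exp_add]
    congr 2
    push_cast
    ring

theorem wrapperRun_good (P : PMF (Ranking m)) (sel : SelectionRule m) {k : ℕ} (hk : 1 ≤ k)
    (hkm : k < m) {ε' δ' a η : ℝ} (hε : 0 < ε') (hδ : 0 < δ') (hδ1 : δ' ≤ 1) (ha : 0 ≤ a)
    (hη : 0 ≤ η) (hη1 : η ≤ 1) {T : ℕ} (hT : 0 < T)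
    (hTb : m * (2 * Real.exp (-2 * T * a ^ 2)) ≤ δ') (t : ℕ) :
    (wrapperRun P sel k ε' δ' T η t).toOuterMeasure
      {s | ¬ s.IsGood P η a (1 - ((1 - 1 / Real.exp 1) * thetaStar P k - ε') + a)} ≤
        ENNReal.ofReal (t * (2 * δ')) := by
  induction t with
  | zero =>
    rw [wrapperRun, PMF.toOuterMeasure_pure_apply, if_neg]
    · exact zero_le
    · rw [Set.mem_ofPred_eq, not_not]
      constructor <;> simp [WrapperState.init]
  | succ t ih =>
    have hsplit : ENNReal.ofReal (((t + 1 : ℕ) : ℝ) * (2 * δ')) =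
        ENNReal.ofReal (t * (2 * δ')) + (ENNReal.ofReal δ' + ENNReal.ofReal δ') := by
      rw [← ENNReal.ofReal_add hδ.le hδ.le, ← ENNReal.ofReal_add (by positivity) (by positivity)]
      congr 1
      push_cast
      ring
    rw [wrapperRun, hsplit]
    refine toOuterMeasure_bind_le ih fun s _ hs => ?_
    exact wrapperRound_good P sel hk hkm hε hδ hδ1 ha hη hη1 hT hTb (not_not.1 hs)

theorem of_mem_support_wrapperRun (P : PMF (Ranking m)) (sel : SelectionRule m) {k : ℕ}
    (hk : 1 ≤ k) (hkm : k < m) {ε' : ℝ} (hε : 0 < ε') (δ' : ℝ) (T : ℕ) (η : ℝ) {t : ℕ}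
    {s : WrapperState m t} (hs : s ∈ (wrapperRun P sel k ε' δ' T η t).support) :
    s.oracleCalls = t ∧ s.auditComparisons ≤ t * (T * m) ∧ ∀ j, (s.committees j).card = k := by
  induction t with
  | zero =>
    rw [wrapperRun, PMF.mem_support_pure_iff] at hs
    subst hs
    exact ⟨rfl, by simp [WrapperState.init], fun j => j.elim0⟩
  | succ t ih =>
    rw [wrapperRun, PMF.mem_support_bind_iff] at hs
    obtain ⟨s₀, hs₀, hs⟩ := hs
    obtain ⟨h1, h2, h3⟩ := ih hs₀
    rw [wrapperRound, PMF.mem_support_bind_iff] at hs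
    obtain ⟨S, hS, hs⟩ := hs
    obtain ⟨v, -, rfl⟩ := (PMF.mem_support_map_iff _ _ _).1 hs
    have hcard := card_of_mem_support_greedyLoop P _ sel hk hkm hε δ' k (by simp) hS
    refine ⟨by rw [h1], ?_, fun j => ?_⟩
    · have hcost : ∑ j, ((auditTask S).run (v j)).2 ≤ T * m := by
        refine (Finset.sum_le_sum fun j _ => (run_auditTask (v j) S).1).trans ?_
        simp
      dsimp only
      rw [add_mul, one_mul]
      exact add_le_add h2 hcost
    · refine Fin.lastCases ?_ (fun i => ?_) j
      · simpa using hcard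
      · simpa using h3 i

/-- A single rival's term is at most the whole potential; taking logarithms gives the regret bound.
-/
theorem gain_le_of_isGood {t : ℕ} {P : PMF (Ranking m)} {η a c : ℝ} (hη : 0 < η)
    {s : WrapperState m t} (hs : s.IsGood P η a c) (x : Fin m) :
    s.gain x ≤ Real.log m / η + t * (c + η) := by
  have hm : (0 : ℝ) < m := by exact_mod_cast Nat.pos_of_ne_zero (NeZero.ne m)
  have h : Real.exp (η * s.gain x) ≤ m * Real.exp (t * (η * c + η ^ 2)) :=
    (Finset.single_le_sum (f := fun x => Real.exp (η * s.gain x))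
      (fun _ _ => Real.exp_nonneg _) (Finset.mem_univ x)).trans hs.2
  have h2 := Real.log_le_log (Real.exp_pos _) h
  rw [Real.log_exp, Real.log_mul hm.ne' (Real.exp_pos _).ne', Real.log_exp] at h2
  have h3 : Real.log m / η + t * (c + η) = (Real.log m + t * (η * c + η ^ 2)) / η := by
    field_simp
  rw [h3, le_div_iff₀ hη, mul_comm]
  exact h2

end Wrapper

/-! ### From the lottery to the union. -/

theorem expect_lottery {m R : ℕ} [NeZero R] (S : Fin R → Finset (Fin m))
    (f : Finset (Fin m) → ℝ) : expect (lottery S) f = (∑ j, f (S j)) / R := by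
  classical
  unfold expect lottery
  have h : ∀ A : Finset (Fin m),
      ((PMF.map S (PMF.uniformOfFintype (Fin R))) A).toReal * f A =
        ∑ j, (if A = S j then f A else 0) / R := by
    intro A
    rw [PMF.map_apply, tsum_fintype, ENNReal.toReal_sum, Finset.sum_mul]
    · refine Finset.sum_congr rfl fun j _ => ?_
      split_ifs
      · simp [PMF.uniformOfFintype_apply, div_eq_inv_mul]
      · simp
    · intro j _
      split_ifs
      · exact PMF.apply_ne_top _ _
      · exact ENNReal.zero_ne_top
  simp only [h]
  rw [Finset.sum_comm, Finset.sum_div]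
  refine Finset.sum_congr rfl fun j _ => ?_
  rw [← Finset.sum_div, Finset.sum_ite_eq' Finset.univ (S j) f, if_pos (Finset.mem_univ _)]

theorem le_theta_unionCommittee {m R : ℕ} [NeZero R] (P : PMF (Ranking m))
    (S : Fin R → Finset (Fin m)) {b : ℝ} (hb : b ≤ 1)
    (h : ∀ x, b ≤ expect (lottery S) (g P x)) : b ≤ theta P (unionCommittee S) := by
  have hR : (0 : ℝ) < R := by exact_mod_cast Nat.pos_of_ne_zero (NeZero.ne R)
  rw [theta]
  split_ifs
  · refine Finset.le_inf' _ _ fun x hx => ?_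
    rw [win_singleton P (Finset.mem_compl.1 hx)]
    refine (h x).trans ?_
    rw [expect_lottery, div_le_iff₀ hR]
    refine (Finset.sum_le_sum fun j _ => g_mono P x
      (Finset.subset_biUnion_of_mem S (Finset.mem_univ j))).trans (le_of_eq ?_)
    rw [Finset.sum_const, Finset.card_univ, Fintype.card_fin, nsmul_eq_mul, mul_comm]
    rfl
  -- If the union contains every expert, `theta` is `1` by convention; hence the hypothesis `b ≤ 1`.
  · exact hb

/-! ### Choice of the number of rounds and audits, and the error budget. -/

/-- The number of rounds of the wrapper. -/
def numRounds (m : ℕ) (ε : ℝ) : ℕ := ⌈256 * (Real.log m / ε ^ 2)⌉₊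

/-- The number of audit tasks per round. -/
def numAudits (m R : ℕ) (ε δ : ℝ) : ℕ := ⌈32 / ε ^ 2 * Real.log (4 * m * R / δ)⌉₊

/-- Absorbs the `+ 1` of a ceiling into the constant: `256 + 2 = 258` for rounds and `96 + 2 = 98`
for audits. -/
theorem one_le_two_mul_log {y : ℝ} (hy : 2 ≤ y) : 1 ≤ 2 * Real.log y := by
  have h1 := Real.log_two_gt_d9
  have h2 := Real.log_le_log two_pos hy
  linarith

theorem one_le_inv_sq {ε : ℝ} (hε : 0 < ε) (hε1 : ε < 1) : 1 ≤ 1 / ε ^ 2 := by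
  rw [one_le_div (by positivity)]
  exact pow_le_one₀ hε.le hε1.le

theorem numRounds_pos {m : ℕ} (hm : 2 ≤ m) {ε : ℝ} (hε : 0 < ε) : 0 < numRounds m ε := by
  have hm' : (1 : ℝ) < m := by exact_mod_cast hm
  have := Real.log_pos hm'
  exact Nat.ceil_pos.2 (by positivity)

theorem numRounds_le {m : ℕ} (hm : 2 ≤ m) {ε : ℝ} (hε : 0 < ε) (hε1 : ε < 1) :
    (numRounds m ε : ℝ) ≤ 258 * (Real.log m / ε ^ 2) := by
  have h1 := one_le_two_mul_log (y := m) (by exact_mod_cast hm)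
  have h2 := one_le_inv_sq hε hε1
  have h3 : 1 ≤ 2 * (Real.log m / ε ^ 2) := by
    calc (1 : ℝ) ≤ 2 * Real.log m * (1 / ε ^ 2) := one_le_mul_of_one_le_of_one_le h1 h2
      _ = _ := by ring
  have h4 := Nat.ceil_lt_add_one (a := 256 * (Real.log m / ε ^ 2)) (by linarith)
  rw [numRounds]
  linarith

theorem numAudits_pos {m R : ℕ} (hm : 2 ≤ m) (hR : 1 ≤ R) {ε δ : ℝ} (hε : 0 < ε) (hδ : 0 < δ)
    (hδ1 : δ < 1) : 0 < numAudits m R ε δ := by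
  have hm' : (2 : ℝ) ≤ m := by exact_mod_cast hm
  have hR' : (1 : ℝ) ≤ R := by exact_mod_cast hR
  have : 0 < Real.log (4 * m * R / δ) := by
    refine Real.log_pos ((one_lt_div hδ).2 ?_)
    nlinarith
  exact Nat.ceil_pos.2 (by positivity)

theorem numAudits_le {m R : ℕ} (hm : 2 ≤ m) (hR : 1 ≤ R) {ε δ : ℝ} (hε : 0 < ε) (hε1 : ε < 1)
    (hδ : 0 < δ) (hδ1 : δ < 1) :
    (numAudits m R ε δ : ℝ) ≤ 98 * (1 / ε ^ 2 * Real.log (m * R / δ)) := by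
  have hm' : (2 : ℝ) ≤ m := by exact_mod_cast hm
  have hR' : (1 : ℝ) ≤ R := by exact_mod_cast hR
  have hy : (2 : ℝ) ≤ m * R / δ := by
    rw [le_div_iff₀ hδ]
    nlinarith
  have h1 := one_le_two_mul_log hy
  have h2 := one_le_inv_sq hε hε1
  have h3 : 1 ≤ 2 * (1 / ε ^ 2 * Real.log (m * R / δ)) := by
    calc (1 : ℝ) ≤ 2 * Real.log (m * R / δ) * (1 / ε ^ 2) := one_le_mul_of_one_le_of_one_le h1 h2
      _ = _ := by ring
  -- For `y ≥ 2` one has `4 * y ≤ y ^ 3`, which removes the factor `4` inside the logarithm.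
  have h4 : Real.log (4 * m * R / δ) ≤ 3 * Real.log (m * R / δ) := by
    have h5 : (4 : ℝ) * m * R / δ ≤ (m * R / δ) ^ 3 := by
      calc (4 : ℝ) * m * R / δ = 2 ^ 2 * (m * R / δ) := by ring
        _ ≤ (m * R / δ) ^ 2 * (m * R / δ) := by gcongr
        _ = _ := by ring
    calc _ ≤ Real.log ((m * R / δ) ^ 3) := Real.log_le_log (by positivity) h5
      _ = _ := by
        rw [Real.log_pow]
        norm_num
  have h6 : 32 / ε ^ 2 * Real.log (4 * m * R / δ) ≤ 96 * (1 / ε ^ 2 * Real.log (m * R / δ)) := by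
    calc _ ≤ 32 / ε ^ 2 * (3 * Real.log (m * R / δ)) := by gcongr
      _ = _ := by ring
  have h7 : 0 ≤ 32 / ε ^ 2 * Real.log (4 * m * R / δ) := by
    refine mul_nonneg (by positivity) (Real.log_nonneg ?_)
    rw [one_le_div hδ]
    nlinarith
  have h8 := Nat.ceil_lt_add_one h7
  rw [numAudits]
  linarith

theorem two_mul_exp_numAudits_le {m R : ℕ} (hm : 2 ≤ m) (hR : 1 ≤ R) {ε δ : ℝ} (hε : 0 < ε)
    (hδ : 0 < δ) :
    (m : ℝ) * (2 * Real.exp (-2 * (numAudits m R ε δ : ℝ) * (ε / 8) ^ 2)) ≤ δ / (2 * R) := by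
  have hm' : (0 : ℝ) < m := by positivity
  have hR' : (0 : ℝ) < R := by positivity
  have h1 : 32 / ε ^ 2 * Real.log (4 * m * R / δ) ≤ numAudits m R ε δ := Nat.le_ceil _
  have h2 : -2 * (numAudits m R ε δ : ℝ) * (ε / 8) ^ 2 ≤ -Real.log (4 * m * R / δ) := by
    have h3 := mul_le_mul_of_nonneg_right h1 (by positivity : 0 ≤ 2 * (ε / 8) ^ 2)
    have h4 : 32 / ε ^ 2 * Real.log (4 * m * R / δ) * (2 * (ε / 8) ^ 2) =
        Real.log (4 * m * R / δ) := by
      field_simp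
      ring
    linarith
  calc _ ≤ (m : ℝ) * (2 * Real.exp (-Real.log (4 * m * R / δ))) := by gcongr
    _ = δ / (2 * R) := by
      rw [Real.exp_neg, Real.exp_log (by positivity)]
      field_simp
      norm_num

/-- Error budget per round: `ε/4` from the oracle, `ε/8` twice from the audit, `ε/16` from the
quadratic term and `ε/16` from `log m / (η R)`, in total `5ε/8`. The constant `256 = 16²` balances
the last two at `η = ε / 16`. -/
theorem le_expect_lottery_of_isGood {m : ℕ} [NeZero m] {ε θ : ℝ} (hε : 0 < ε) {R : ℕ} [NeZero R]
    (hR : 256 * (Real.log m / ε ^ 2) ≤ R) {P : PMF (Ranking m)} {s : WrapperState m R}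
    (hs : s.IsGood P (ε / 16) (ε / 8) (1 - (θ - ε / 4) + ε / 8)) (x : Fin m) :
    θ - ε ≤ expect (lottery s.committees) (g P x) := by
  have hR0 : (0 : ℝ) < R := by exact_mod_cast Nat.pos_of_ne_zero (NeZero.ne R)
  have h1 := gain_le_of_isGood (by positivity) hs x
  have h2 := hs.1 x
  have h3 : Real.log m / (ε / 16) ≤ R * (ε / 16) := by
    have h4 := mul_le_mul_of_nonneg_right hR (by positivity : 0 ≤ ε / 16)
    refine le_trans (le_of_eq ?_) h4
    field_simp
    norm_num
  rw [Finset.sum_sub_distrib, Finset.sum_const, Finset.card_univ, Fintype.card_fin,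
    nsmul_eq_mul, mul_one] at h2
  rw [expect_lottery, le_div_iff₀ hR0]
  have h5 := mul_pos hR0 hε
  linarith

end PairwiseCommittee

end

theorem theorem5p11 :
    ∃ K : ℝ, 0 < K ∧
      ∀ (m k : ℕ) [NeZero m] (ε δ : ℝ), 1 ≤ k → k < m → 0 < ε → ε < 1 → 0 < δ → δ < 1 →
        ∃ (R T : ℕ) (_ : NeZero R) (η : ℝ),
          0 < η ∧
          (R : ℝ) ≤ K * (Real.log (m : ℝ) / ε ^ 2) ∧
          ∀ (P : PMF (Ranking m)) (sel : SelectionRule m),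
            (∀ s ∈ (minimaxWrapper P sel k ε δ R T η).support,
              s.oracleCalls = R ∧
              (s.auditComparisons : ℝ) ≤
                K * ((R : ℝ) * ((m : ℝ) / ε ^ 2) * Real.log ((m : ℝ) * (R : ℝ) / δ)) ∧
              (∀ t : Fin R, (s.committees t).card = k) ∧
              (unionCommittee s.committees).card ≤ k * R) ∧
            1 - δ ≤ prob (minimaxWrapper P sel k ε δ R T η)
              {s | (∀ x : Fin m,
                      (1 - 1 / Real.exp 1) * thetaStar P k - ε ≤
                        expect (lottery s.committees) (g P x)) ∧
                    (1 - 1 / Real.exp 1) * thetaStar P k - ε ≤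
                      theta P (unionCommittee s.committees)} := by
  refine ⟨258, by norm_num, fun m k _ ε δ hk hkm hε hε1 hδ hδ1 => ?_⟩
  have hm : 2 ≤ m := by omega
  have hR := numRounds_pos hm hε
  set R := numRounds m ε
  have hT := numAudits_pos hm hR hε hδ hδ1
  have hTle := numAudits_le hm hR hε hε1 hδ hδ1
  have hTexp := two_mul_exp_numAudits_le hm hR hε hδ
  set T := numAudits m R ε δ
  have hR1 : (1 : ℝ) ≤ R := by exact_mod_cast hR
  have hR0 : (R : ℝ) ≠ 0 := by positivity
  have : NeZero R := ⟨hR.ne'⟩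
  refine ⟨R, T, this, ε / 16, by positivity, numRounds_le hm hε hε1, fun P sel => ⟨?_, ?_⟩⟩
  · intro s hs
    obtain ⟨hcalls, hcost, hcard⟩ := of_mem_support_wrapperRun P sel hk hkm (by positivity) _ _ _ hs
    refine ⟨hcalls, ?_, hcard, ?_⟩
    · calc (s.auditComparisons : ℝ) ≤ R * (T * m) := by exact_mod_cast hcost
        _ ≤ R * (98 * (1 / ε ^ 2 * Real.log (m * R / δ)) * m) := by gcongr
        _ = 98 * (R * (m / ε ^ 2) * Real.log (m * R / δ)) := by ring
        _ ≤ _ := by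
          have hm' : (1 : ℝ) ≤ m := by exact_mod_cast hm.trans' one_le_two
          have hlog : 0 ≤ Real.log (m * R / δ) := by
            refine Real.log_nonneg ((one_le_div hδ).2 ?_)
            nlinarith
          gcongr
          norm_num
    · refine Finset.card_biUnion_le.trans (le_of_eq ?_)
      simp [hcard, mul_comm]
  · refine one_sub_le_prob hδ.le ?_
    -- Oracle and audit each fail with probability at most `δ / (2R)` per round, so `R` rounds use
    -- up exactly `δ`.
    have hgood := wrapperRun_good P sel hk hkm (ε' := ε / 4) (δ' := δ / (2 * R)) (a := ε / 8)
      (η := ε / 16) (by positivity) (by positivity)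
      ((div_le_one (by positivity)).2 (by linarith)) (by positivity) (by positivity) (by linarith)
      hT hTexp R
    rw [show (R : ℝ) * (2 * (δ / (2 * R))) = δ by field_simp] at hgood
    refine (MeasureTheory.measure_mono ?_).trans hgood
    intro s hs hs'
    have hlot := le_expect_lottery_of_isGood hε (R := R) (Nat.le_ceil _) hs'
    refine hs ⟨hlot, le_theta_unionCommittee P s.committees ?_ hlot⟩
    have h1 := mul_le_mul_of_nonneg_left (thetaStar_le_one P hkm) one_sub_exp_neg_one_nonneg
    have h2 : 0 < 1 / Real.exp 1 := by positivity
    linarith
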